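/- Let $\Gamma$ be a discrete group, let $\Theta:\Gamma\times\Gamma\to S^1$ be a normalized 2-cocycle, i.e. $\Theta(a,b)\Theta(ab,c)=\Theta(a,bc)\Theta(b,c)$ for all $a,b,c\in\Gamma$ and $\Theta(e,e)=1$, and let $\mathcal H$ be a complex Hilbert space. (In the setting of gauge-periodic operators, $\Gamma$ acts freely, isometrically, properly discontinuously and cocompactly on a Riemannian manifold $X$ with fundamental domain $\mathcal D$, a projective unitary representation $U$ of $\Gamma$ on the $L^2$-sections of a Hermitian vector bundle $E\to X$ lifts this action, $U_{\gamma_1}U_{\gamma_2}=\Theta(\gamma_1,\gamma_2)U_{\gamma_1\gamma_2}$ with $\Theta$ constant on $X$, and $\mathcal H=L^2(E|_{\mathcal D})$.) On $\ell^2(\Gamma)$ define the twisted right and left translations $$(R^\Theta_\gamma f)(g)=\Theta(g,\gamma)\,f(g\gamma),\qquad (L^\Theta_\gamma f)(g)=\overline{\Theta(\gamma,\gamma^{-1}g)}\,f(\gamma^{-1}g).$$ Let $\mathcal A=C^*_r(\Gamma,\Theta)$ be the $C^*$-algebra generated by the $R^\Theta_\gamma$, and $C^*_r(\Gamma,\Theta)^L$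 the $C^*$-algebra generated by the $L^\Theta_\gamma$. Let $\mathcal E=\mathcal H\otimes\mathcal A$ be the left Hilbert $\mathcal A$-module obtained by completing the algebraic tensor product with respect to the $\mathcal A$-valued scalar product $\langle a_1\otimes f_1\,|\,a_2\otimes f_2\rangle=\langle f_2|f_1\rangle\,a_1a_2^*$ (scalar products of $\mathcal H$ are linear in the second entry; elementary tensors are written with the $\mathcal A$-factor first). Let $\mathcal K_{\mathcal A}(\mathcal E)$ be the $C^*$-algebra of $\mathcal A$-compact operators: the norm closure, in the adjointable operators on $\mathcal E$, of the linear span of the operators $\pi_{x,y}:z\mapsto\langle z|x\rangle y$, for $x,y\in\mathcal E$. Let $\mathcal K$ be the $C^*$-algebra of compact operators on $\mathcal H$. Then the opposite algebra $\mathcal A^{op}$ is $C^*_r(\Gamma,\Theta)^L$, and $$\mathcal K_{\mathcal A}(\mathcal E)\simeq\mathcal A^{op}\otimes\mathcal K .$$ More precisely, there is a $*$-isomorphism $\varphi:\mathcal A^{op}\to C^*_r(\Gamma,\Theta)^L$ with $\varphi\big(((R^\Theta_\gamma)^*)^{op}\big)=L^\Theta_\gamma$ for all $\gamma\in\Gamma$,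 and a $*$-isomorphism $\Psi$ from $\mathcal K_{\mathcal A}(\mathcal E)$ onto the spatial tensor product $C^*_r(\Gamma,\Theta)^L\otimes\mathcal K$, acting on $\ell^2(\Gamma)\otimes\mathcal H$, such that for all $a,b\in\mathcal A$ and $f,g\in\mathcal H$ $$\Psi(\pi_{a\otimes f,\,b\otimes g})=\varphi\big((a^*b)^{op}\big)\otimes|g\rangle\langle f| .$$ -/

import Mathlib

open scoped TensorProduct ComplexOrder InnerProductSpace ENNReal

namespace GaugePeriodic

noncomputable section

/-! ## Left Hilbert modules over a C⋆-algebra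

Mathlib's class `CStarModule A E` is used: `A` acts on `E` from the left, and the `A`-valued scalar
product `⟨e | f⟩` that is `A`-linear in its *first* entry (the convention for left Hilbert modules)
is `inner A f e`. Indeed `inner A f (a • e) = a * inner A f e`, `inner A f (z • e) = z • inner A f e`,
`star (inner A f e) = inner A e f`, and the norm is `‖e‖ = √‖inner A e e‖`.
A left Hilbert module is a complete one. -/

section Module

variable (A : Type*) {E : Type*} [CStarAlgebra A] [PartialOrder A] [StarOrderedRing A]
  [NormedAddCommGroup E] [NormedSpace ℂ E] [SMul A E] [CStarModule A E]

theorem ext_inner {x y : E} (h : ∀ z : E, inner A z x = inner A z y) : x = y := by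
  have h0 : inner A (x - y) (x - y) = 0 := by
    rw [CStarModule.inner_sub_right, h, sub_self]
  exact sub_eq_zero.1 (CStarModule.inner_self.1 h0)

theorem norm_smul_le' (a : A) (x : E) : ‖a • x‖ ≤ ‖a‖ * ‖x‖ := by
  rw [← abs_of_nonneg (norm_nonneg (a • x)), ← abs_of_nonneg (by positivity : 0 ≤ ‖a‖ * ‖x‖),
    ← sq_le_sq, CStarModule.norm_sq_eq A, CStarModule.inner_op_smul_left,
    CStarModule.inner_op_smul_right, mul_pow, CStarModule.norm_sq_eq A (x := x)]
  calc ‖a * inner A x x * star a‖ ≤ ‖a‖ * ‖inner A x x‖ * ‖star a‖ :=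
        (norm_mul_le _ _).trans (by gcongr; exact norm_mul_le _ _)
    _ = ‖a‖ ^ 2 * ‖inner A x x‖ := by rw [norm_star]; ring

variable (E) in
/-- `𝓛_A(E)`: the adjointable operators on `E`, i.e. the bounded operators `T` for which there is a
bounded `S` with `⟨e | T f⟩ = ⟨S e | f⟩`. -/
def adjointableSubalgebra : Subalgebra ℂ (E →L[ℂ] E) where
  carrier := {T | ∃ S : E →L[ℂ] E, ∀ e f : E, inner A (T f) e = inner A f (S e)}
  mul_mem' := by
    rintro T T' ⟨S, hS⟩ ⟨S', hS'⟩
    exact ⟨S' * S, fun e f => by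
      rw [mul_apply_eq_comp, mul_apply_eq_comp, hS, hS']⟩
  add_mem' := by
    rintro T T' ⟨S, hS⟩ ⟨S', hS'⟩
    exact ⟨S + S', fun e f => by
      rw [add_apply, add_apply, CStarModule.inner_add_left,
        CStarModule.inner_add_right, hS, hS']⟩
  algebraMap_mem' := fun z => ⟨algebraMap ℂ _ (star z), fun e f => by
    simp [Algebra.algebraMap_eq_smul_one]⟩

variable (E) in
/-- The algebra `𝓛_A(E)` of adjointable operators as a type; it carries the operator norm. -/
def Adjointable : Type _ := adjointableSubalgebra A E

instance : NormedRing (Adjointable A E) := inferInstanceAs (NormedRing (adjointableSubalgebra A E))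
instance : NormedAlgebra ℂ (Adjointable A E) :=
  inferInstanceAs (NormedAlgebra ℂ (adjointableSubalgebra A E))

variable {A}

/-- The adjoint of an adjointable operator. -/
instance : Star (Adjointable A E) where
  star T := ⟨T.2.choose, T.1, fun e f => by
    have h := congrArg star (T.2.choose_spec f e)
    rw [CStarModule.star_inner, CStarModule.star_inner] at h
    exact h.symm⟩

/-- The defining property of the adjoint: `⟨e | T f⟩ = ⟨T⋆ e | f⟩`. -/
theorem inner_adjointable (T : Adjointable A E) (e f : E) :
    inner A (T.1 f) e = inner A f ((star T).1 e) := T.2.choose_spec e f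

theorem adjoint_unique {T : Adjointable A E} {S : Adjointable A E}
    (h : ∀ e f : E, inner A (T.1 f) e = inner A f (S.1 e)) : star T = S := by
  refine Subtype.ext (ContinuousLinearMap.ext fun e => ext_inner A fun f => ?_)
  rw [← inner_adjointable, h]

theorem inner_adjointable' (T : Adjointable A E) (e f : E) :
    inner A ((star T).1 f) e = inner A f (T.1 e) := by
  have h := congrArg star (inner_adjointable T f e)
  rw [CStarModule.star_inner, CStarModule.star_inner] at h
  exact h.symm

instance : StarRing (Adjointable A E) where
  star_involutive T := adjoint_unique fun e f => inner_adjointable' T e f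
  star_mul S T := adjoint_unique fun e f => by
    change inner A (S.1 (T.1 f)) e = inner A f ((star T).1 ((star S).1 e))
    rw [inner_adjointable, inner_adjointable]
  star_add S T := adjoint_unique fun e f => by
    change inner A (S.1 f + T.1 f) e = inner A f ((star S).1 e + (star T).1 e)
    rw [CStarModule.inner_add_left, CStarModule.inner_add_right, inner_adjointable,
      inner_adjointable]

instance : StarModule ℂ (Adjointable A E) where
  star_smul z T := adjoint_unique fun e f => by
    change inner A (z • T.1 f) e = inner A f (star z • (star T).1 e)
    rw [CStarModule.inner_smul_left_complex, CStarModule.inner_smul_right_complex,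
      inner_adjointable]

theorem norm_star_le (T : Adjointable A E) : ‖star T‖ ≤ ‖T‖ := by
  refine ContinuousLinearMap.opNorm_le_bound (star T).1 (norm_nonneg _) fun e => ?_
  rcases eq_or_ne ((star T).1 e) 0 with h | h
  · rw [h, norm_zero]; positivity
  · have h1 : ‖(star T).1 e‖ ^ 2 ≤ ‖T‖ * ‖e‖ * ‖(star T).1 e‖ := by
      rw [CStarModule.norm_sq_eq A, ← inner_adjointable]
      refine (CStarModule.norm_inner_le E).trans ?_
      calc ‖T.1 ((star T).1 e)‖ * ‖e‖ ≤ (‖T.1‖ * ‖(star T).1 e‖) * ‖e‖ := by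
            gcongr; exact T.1.le_opNorm _
        _ = ‖T‖ * ‖e‖ * ‖(star T).1 e‖ := by
            rw [show ‖T‖ = ‖T.1‖ from rfl]; ring
    have h2 : 0 < ‖(star T).1 e‖ := norm_pos_iff.2 h
    rw [pow_two] at h1
    exact le_of_mul_le_mul_right h1 h2

instance : ContinuousStar (Adjointable A E) where
  continuous_star := by
    refine (LipschitzWith.of_dist_le_mul (K := 1) fun S T => ?_).continuous
    rw [dist_eq_norm, dist_eq_norm, NNReal.coe_one, one_mul]
    exact (congrArg norm (star_sub S T).symm).le.trans (norm_star_le _)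

variable (A)

/-- The operator `π_{e,f} : x ↦ ⟨x | e⟩ f` on a left Hilbert module, as a bounded operator. -/
def rankOneCLM (e f : E) : E →L[ℂ] E :=
  LinearMap.mkContinuous
    { toFun := fun x => (inner A e x : A) • f
      map_add' := fun x y => ext_inner A fun z => by
        simp [add_mul]
      map_smul' := fun c x => ext_inner A fun z => by
        simp }
    (‖e‖ * ‖f‖) (fun x => by
      refine (norm_smul_le' A _ _).trans ?_
      calc ‖(inner A e x : A)‖ * ‖f‖ ≤ (‖e‖ * ‖x‖) * ‖f‖ := by
            gcongr; exact CStarModule.norm_inner_le E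
        _ = ‖e‖ * ‖f‖ * ‖x‖ := by ring)

theorem rankOneCLM_apply (e f x : E) : rankOneCLM A e f x = (inner A e x : A) • f := rfl

theorem inner_rankOneCLM (e f x y : E) :
    inner A (rankOneCLM A e f y) x = inner A y (rankOneCLM A f e x) := by
  simp [rankOneCLM_apply]

/-- The adjointable operator `π_{e,f} : x ↦ ⟨x | e⟩ f` on a left Hilbert module. -/
def rankOne (e f : E) : Adjointable A E :=
  ⟨rankOneCLM A e f, rankOneCLM A f e, fun x y => inner_rankOneCLM A e f x y⟩

theorem star_rankOne (e f : E) : star (rankOne A e f) = rankOne A f e :=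
  adjoint_unique fun x y => inner_rankOneCLM A e f x y

theorem mul_rankOne (T : Adjointable A E) (e f : E) :
    T * rankOne A e f = rankOne A e (T.1 f) := by
  refine Subtype.ext (ContinuousLinearMap.ext fun x => ext_inner A fun z => ?_)
  change inner A z (T.1 ((inner A e x : A) • f)) = inner A z ((inner A e x : A) • T.1 f)
  rw [← inner_adjointable', CStarModule.inner_op_smul_right, CStarModule.inner_op_smul_right,
    inner_adjointable']

variable (E)

/-- `𝓕_A(E)`: the `A`-finite operators, the linear span of the operators `π_{e,f}`. -/
def finiteOperators : Submodule ℂ (Adjointable A E) :=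
  Submodule.span ℂ {T | ∃ e f : E, T = rankOne A e f}

theorem mul_mem_finiteOperators (T : Adjointable A E) {S : Adjointable A E}
    (hS : S ∈ finiteOperators A E) : T * S ∈ finiteOperators A E := by
  induction hS using Submodule.span_induction with
  | mem S h =>
    obtain ⟨e, f, rfl⟩ := h
    rw [mul_rankOne]
    exact Submodule.subset_span ⟨_, _, rfl⟩
  | zero => rw [mul_zero]; exact zero_mem _
  | add S S' _ _ h h' => rw [mul_add]; exact add_mem h h'
  | smul z S _ h => rw [mul_smul_comm]; exact Submodule.smul_mem _ z h

theorem star_mem_finiteOperators {S : Adjointable A E}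
    (hS : S ∈ finiteOperators A E) : star S ∈ finiteOperators A E := by
  induction hS using Submodule.span_induction with
  | mem S h =>
    obtain ⟨e, f, rfl⟩ := h
    rw [star_rankOne]
    exact Submodule.subset_span ⟨_, _, rfl⟩
  | zero => rw [star_zero]; exact zero_mem _
  | add S S' _ _ h h' => rw [star_add]; exact add_mem h h'
  | smul z S _ h => rw [star_smul]; exact Submodule.smul_mem _ _ h

/-- `𝓚_A(E)`: the `A`-compact operators, the norm closure of the `A`-finite operators in the
algebra `𝓛_A(E)` of adjointable operators. -/
def compacts : NonUnitalStarSubalgebra ℂ (Adjointable A E) where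
  carrier := closure (finiteOperators A E : Set (Adjointable A E))
  add_mem' := fun h h' => (finiteOperators A E).topologicalClosure.add_mem h h'
  zero_mem' := (finiteOperators A E).topologicalClosure.zero_mem
  smul_mem' := fun z _ h => (finiteOperators A E).topologicalClosure.smul_mem z h
  mul_mem' := fun h h' => map_mem_closure₂ continuous_mul h h' fun T _ _ hS =>
    mul_mem_finiteOperators A E T hS
  star_mem' := fun h => map_mem_closure continuous_star h fun _ hS =>
    star_mem_finiteOperators A E hS

variable {E}

theorem rankOne_mem (e f : E) : rankOne A e f ∈ compacts A E :=
  subset_closure (Submodule.subset_span ⟨e, f, rfl⟩)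

variable (E) in
/-- The algebra `𝓚_A(E)` of `A`-compact operators as a type, with the operations and the norm of
`𝓛_A(E)`. -/
def CompactAlgebra : Type _ := compacts A E

instance : NonUnitalNormedRing (CompactAlgebra A E) :=
  inferInstanceAs (NonUnitalNormedRing (compacts A E))
instance : StarRing (CompactAlgebra A E) := inferInstanceAs (StarRing (compacts A E))
instance : Module ℂ (CompactAlgebra A E) := inferInstanceAs (Module ℂ (compacts A E))
instance : IsScalarTower ℂ (CompactAlgebra A E) (CompactAlgebra A E) :=
  inferInstanceAs (IsScalarTower ℂ (compacts A E) (compacts A E))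
instance : SMulCommClass ℂ (CompactAlgebra A E) (CompactAlgebra A E) :=
  inferInstanceAs (SMulCommClass ℂ (compacts A E) (compacts A E))
instance : StarModule ℂ (CompactAlgebra A E) := inferInstanceAs (StarModule ℂ (compacts A E))

/-- The operator `π_{e,f}` as an element of `𝓚_A(E)`. -/
def CompactAlgebra.rankOne (e f : E) : CompactAlgebra A E :=
  (⟨GaugePeriodic.rankOne A e f, rankOne_mem A e f⟩ : compacts A E)

end Module

/-! ## The completion of a left pre-Hilbert module -/

section Completion

open UniformSpace

variable {A : Type*} {E : Type*} [CStarAlgebra A] [PartialOrder A] [StarOrderedRing A]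
  [NormedAddCommGroup E] [NormedSpace ℂ E] [Module A E] [CStarModule A E]

variable (A E) in
theorem uniformContinuousConstSMul : UniformContinuousConstSMul A E where
  uniformContinuous_const_smul a := by
    refine (AddMonoidHomClass.lipschitz_of_bound (DistribSMul.toAddMonoidHom E a) ‖a‖
      fun x => ?_).uniformContinuous
    exact norm_smul_le' A a x

theorem completion_inner_coe (a b : E) :
    inner A (a : Completion E) (b : Completion E) = inner A a b :=
  (Completion.isDenseInducing_coe.prodMap Completion.isDenseInducing_coe).extend_eq
    (CStarModule.continuous_inner (A := A) (E := E)) (a, b)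

theorem completion_continuous_inner :
    Continuous (fun p : Completion E × Completion E => inner A p.1 p.2) := by
  let inner' : E →+ E →+ A :=
    { toFun := fun x => (CStarModule.innerₛₗ (A := A) x).toAddMonoidHom
      map_zero' := by ext x; exact CStarModule.inner_zero_left
      map_add' := fun x y => by ext z; exact CStarModule.inner_add_left }
  have h : Continuous fun p : E × E => inner' p.1 p.2 :=
    CStarModule.continuous_inner (A := A) (E := E)
  exact (Completion.isDenseInducing_toCompl E).extend_Z_bilin
    (Completion.isDenseInducing_toCompl E) h

theorem completion_inner {α : Type*} [TopologicalSpace α] {f g : α → Completion E}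
    (hf : Continuous f) (hg : Continuous g) : Continuous (fun x : α => inner A (f x) (g x)) :=
  completion_continuous_inner.comp (hf.prodMk hg)

theorem completion_norm_eq (x : Completion E) : ‖x‖ = √‖inner A x x‖ :=
  Completion.induction_on x
    (isClosed_eq continuous_norm (completion_inner continuous_id continuous_id).norm.sqrt)
    fun a => by
      rw [Completion.norm_coe, completion_inner_coe,
        CStarModule.norm_eq_sqrt_norm_inner_self (A := A)]

variable [UniformContinuousConstSMul A E]

/-- The completion of a left pre-Hilbert module in its norm is a left Hilbert module; the action
and the scalar product are the continuous extensions. -/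
@[reducible] def completionCStarModule : CStarModule A (Completion E) where
  inner_add_right {x y z} := Completion.induction_on₃ x y z
    (isClosed_eq (completion_inner (by fun_prop) (by fun_prop))
      ((completion_inner (by fun_prop) (by fun_prop)).add
        (completion_inner (by fun_prop) (by fun_prop))))
    fun a b c => by
      rw [← Completion.coe_add, completion_inner_coe, completion_inner_coe, completion_inner_coe,
        CStarModule.inner_add_right]
  inner_self_nonneg {x} := Completion.induction_on x
    (isClosed_le continuous_const (completion_inner continuous_id continuous_id))
    fun a => by rw [completion_inner_coe]; exact CStarModule.inner_self_nonneg
  inner_self {x} := by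
    have h := completion_norm_eq (A := A) x
    constructor
    · intro h0
      rw [h0, norm_zero, Real.sqrt_zero] at h
      exact norm_eq_zero.1 h
    · rintro rfl
      rw [← Completion.coe_zero, completion_inner_coe, CStarModule.inner_zero_left]
  inner_op_smul_right {a x y} := Completion.induction_on₂ x y
    (isClosed_eq (completion_inner (by fun_prop) (continuous_snd.const_smul a))
      (continuous_const.mul (completion_inner (by fun_prop) (by fun_prop))))
    fun b c => by
      rw [← Completion.coe_smul, completion_inner_coe, completion_inner_coe,
        CStarModule.inner_op_smul_right]
  inner_smul_right_complex {z x y} := Completion.induction_on₂ x y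
    (isClosed_eq (completion_inner (by fun_prop) (continuous_snd.const_smul z))
      ((completion_inner (by fun_prop) (by fun_prop)).const_smul z))
    fun b c => by
      rw [← Completion.coe_smul, completion_inner_coe, completion_inner_coe,
        CStarModule.inner_smul_right_complex]
  star_inner x y := Completion.induction_on₂ x y
    (isClosed_eq (completion_inner (by fun_prop) (by fun_prop)).star
      (completion_inner (by fun_prop) (by fun_prop)))
    fun b c => by rw [completion_inner_coe, completion_inner_coe, CStarModule.star_inner]
  norm_eq_sqrt_norm_inner_self x := completion_norm_eq x

end Completion

/-! ## The left Hilbert module `A ⊗ H` -/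

section HilbertTensor

variable (A H : Type*) [CStarAlgebra A] [NormedAddCommGroup H] [InnerProductSpace ℂ H]

/-- The algebraic tensor product `A ⊗ H` over `ℂ`, carrying the norm of its `A`-valued scalar
product. -/
def PreTensor : Type _ := A ⊗[ℂ] H

instance : AddCommGroup (PreTensor A H) := inferInstanceAs (AddCommGroup (A ⊗[ℂ] H))
instance : Module ℂ (PreTensor A H) := inferInstanceAs (Module ℂ (A ⊗[ℂ] H))
instance : Module A (PreTensor A H) := inferInstanceAs (Module A (A ⊗[ℂ] H))

variable {A H}

/-- The elementary tensor `a ⊗ f` in the algebraic tensor product. -/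
def PreTensor.tmul (a : A) (f : H) : PreTensor A H := a ⊗ₜ[ℂ] f

variable (A H)

/-- The sesquilinear form on the algebraic tensor product `A ⊗ H` with values in `A`, linear in its
second entry, with `(a ⊗ f, b ⊗ g) ↦ ⟪f, g⟫ • (b * star a)`. -/
def preInner : A ⊗[ℂ] H →ₗ⋆[ℂ] A ⊗[ℂ] H →ₗ[ℂ] A :=
  ((TensorProduct.lift (TensorProduct.mapBilinear (.id ℂ) A H A ℂ)).compr₂
      (TensorProduct.rid ℂ A).toLinearMap) ∘ₛₗ
    TensorProduct.map
      ((LinearMap.mul ℂ A).flip ∘ₛₗ (starLinearEquiv ℂ : A ≃ₗ⋆[ℂ] A).toLinearMap) (innerₛₗ ℂ)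

theorem preInner_tmul (a b : A) (f g : H) :
    preInner A H (a ⊗ₜ f) (b ⊗ₜ g) = (inner ℂ f g) • (b * star a) := rfl

instance : Inner A (PreTensor A H) where
  inner x y := preInner A H x y

variable {A H}

theorem exists_orthonormal (x : A ⊗[ℂ] H) :
    ∃ (n : ℕ) (e : Fin n → H) (a : Fin n → A), Orthonormal ℂ e ∧ x = ∑ i, a i ⊗ₜ[ℂ] e i := by
  obtain ⟨s, rfl⟩ := TensorProduct.exists_finset x
  classical
  let V : Submodule ℂ H := Submodule.span ℂ (s.image Prod.snd : Finset H)
  have : FiniteDimensional ℂ V := FiniteDimensional.span_finset ℂ _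
  let e := stdOrthonormalBasis ℂ V
  refine ⟨_, fun i => (e i : H), fun i => ∑ p ∈ s, (inner ℂ (e i : H) p.2) • p.1,
    e.orthonormal.comp_linearIsometry V.subtypeₗᵢ, ?_⟩
  simp_rw [TensorProduct.sum_tmul]
  rw [Finset.sum_comm]
  refine Finset.sum_congr rfl fun p hp => ?_
  have hpV : p.2 ∈ V := Submodule.subset_span (by
    rw [Finset.mem_coe]; exact Finset.mem_image_of_mem _ hp)
  have h1 : p.2 = ∑ i, (inner ℂ (e i : H) p.2) • (e i : H) := by
    have h := congrArg (fun v : V => (v : H)) (e.sum_repr' ⟨p.2, hpV⟩)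
    simpa using h.symm
  conv_lhs => rw [h1, TensorProduct.tmul_sum]
  refine Finset.sum_congr rfl fun i _ => ?_
  rw [TensorProduct.tmul_smul, TensorProduct.smul_tmul']

theorem preInner_sum {n : ℕ} {e : Fin n → H} (he : Orthonormal ℂ e) (a : Fin n → A) :
    preInner A H (∑ i, a i ⊗ₜ[ℂ] e i) (∑ i, a i ⊗ₜ[ℂ] e i) = ∑ i, a i * star (a i) := by
  classical
  simp only [map_sum, LinearMap.sum_apply, preInner_tmul, orthonormal_iff_ite.1 he]
  simp

theorem preInner_smul (a : A) (x y : A ⊗[ℂ] H) :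
    preInner A H x (a • y) = a * preInner A H x y := by
  induction x with
  | zero => simp
  | add x x' h h' =>
    simp only [map_add, LinearMap.add_apply, mul_add] at h h' ⊢
    rw [h, h']
  | tmul b f =>
    induction y with
    | zero => simp
    | add y y' h h' => rw [smul_add, map_add, map_add, h, h', mul_add]
    | tmul c g =>
      rw [TensorProduct.smul_tmul', preInner_tmul, preInner_tmul, smul_eq_mul, mul_smul_comm,
        mul_assoc]

theorem star_preInner (x y : A ⊗[ℂ] H) : star (preInner A H x y) = preInner A H y x := by
  induction x with
  | zero => simp
  | add x x' h h' =>
    simp only [map_add, LinearMap.add_apply, star_add] at h h' ⊢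
    rw [h, h']
  | tmul b f =>
    induction y with
    | zero => simp
    | add y y' h h' =>
      simp only [map_add, LinearMap.add_apply, star_add] at h h' ⊢
      rw [h, h']
    | tmul c g =>
      rw [preInner_tmul, preInner_tmul, star_smul, star_mul, star_star]
      congr 1
      exact inner_conj_symm g f

variable [PartialOrder A] [StarOrderedRing A]

instance : Norm (PreTensor A H) := CStarModule.norm A

/-- The `A`-valued scalar product `⟨a ⊗ f | b ⊗ g⟩ = ⟪g, f⟫ • (a * star b)` makes the algebraic
tensor product a left pre-Hilbert module. -/
instance : CStarModule A (PreTensor A H) where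
  inner_add_right {x y z} := map_add (preInner A H x) y z
  inner_self_nonneg {x} := by
    obtain ⟨n, e, a, he, hx⟩ := exists_orthonormal (A := A) (H := H) x
    change 0 ≤ preInner A H x x
    rw [hx, preInner_sum he]
    exact Finset.sum_nonneg fun i _ => mul_star_self_nonneg _
  inner_self {x} := by
    change preInner A H x x = 0 ↔ x = 0
    constructor
    · obtain ⟨n, e, a, he, hx⟩ := exists_orthonormal (A := A) (H := H) x
      intro h
      rw [hx, preInner_sum he,
        Finset.sum_eq_zero_iff_of_nonneg fun i _ => mul_star_self_nonneg _] at h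
      refine hx.trans (Finset.sum_eq_zero fun i hi => ?_)
      rw [(CStarRing.mul_star_self_eq_zero_iff _).1 (h i hi), TensorProduct.zero_tmul]
    · rintro rfl
      exact map_zero (preInner A H _)
  inner_op_smul_right {a x y} := preInner_smul a x y
  inner_smul_right_complex {z x y} := map_smul (preInner A H x) z y
  star_inner x y := star_preInner x y
  norm_eq_sqrt_norm_inner_self _ := rfl

instance : NormedAddCommGroup (PreTensor A H) := CStarModule.normedAddCommGroup A
instance : NormedSpace ℂ (PreTensor A H) := .ofCore (CStarModule.normedSpaceCore A)
instance : UniformContinuousConstSMul A (PreTensor A H) :=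
  uniformContinuousConstSMul A (PreTensor A H)

variable (A H) in
/-- The left Hilbert `A`-module `A ⊗ H`: the completion of the algebraic tensor product. -/
def HilbertTensor : Type _ := UniformSpace.Completion (PreTensor A H)

instance : NormedAddCommGroup (HilbertTensor A H) :=
  inferInstanceAs (NormedAddCommGroup (UniformSpace.Completion (PreTensor A H)))
instance : NormedSpace ℂ (HilbertTensor A H) :=
  inferInstanceAs (NormedSpace ℂ (UniformSpace.Completion (PreTensor A H)))
instance : CompleteSpace (HilbertTensor A H) :=
  inferInstanceAs (CompleteSpace (UniformSpace.Completion (PreTensor A H)))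
instance : Module A (HilbertTensor A H) :=
  inferInstanceAs (Module A (UniformSpace.Completion (PreTensor A H)))
instance : CStarModule A (HilbertTensor A H) :=
  completionCStarModule (A := A) (E := PreTensor A H)

/-- The elementary tensor `a ⊗ f` in the left Hilbert module `A ⊗ H`. -/
def tmul (a : A) (f : H) : HilbertTensor A H :=
  ((PreTensor.tmul a f : PreTensor A H) : UniformSpace.Completion (PreTensor A H))

theorem inner_tmul (a b : A) (f g : H) :
    inner A (tmul a f) (tmul b g) = (inner ℂ f g : ℂ) • (b * star a) :=
  completion_inner_coe _ _

end HilbertTensor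

/-! ## Spatial tensor products and compact operators -/

section Spatial

variable {H₁ H₂ : Type*} [NormedAddCommGroup H₁] [InnerProductSpace ℂ H₁] [CompleteSpace H₁]
  [NormedAddCommGroup H₂] [InnerProductSpace ℂ H₂] [CompleteSpace H₂]

variable (H₁ H₂) in
/-- The Hilbert space tensor product of `H₁` and `H₂`: the completion of the algebraic one. -/
def HilbertProd : Type _ := UniformSpace.Completion (H₁ ⊗[ℂ] H₂)

instance : NormedAddCommGroup (HilbertProd H₁ H₂) :=
  inferInstanceAs (NormedAddCommGroup (UniformSpace.Completion (H₁ ⊗[ℂ] H₂)))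
instance : InnerProductSpace ℂ (HilbertProd H₁ H₂) :=
  inferInstanceAs (InnerProductSpace ℂ (UniformSpace.Completion (H₁ ⊗[ℂ] H₂)))
instance : CompleteSpace (HilbertProd H₁ H₂) :=
  inferInstanceAs (CompleteSpace (UniformSpace.Completion (H₁ ⊗[ℂ] H₂)))

/-- The operator `s ⊗ t` on the Hilbert space tensor product of `H₁` and `H₂`. -/
def opTensor (s : H₁ →L[ℂ] H₁) (t : H₂ →L[ℂ] H₂) :
    HilbertProd H₁ H₂ →L[ℂ] HilbertProd H₁ H₂ :=
  (TensorProduct.mapL s t).completion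

/-- The C⋆-algebra tensor product of two algebras of operators (the spatial one): the C⋆-algebra
of operators on the Hilbert space tensor product generated by the `s ⊗ t` with `s ∈ S`, `t ∈ T`. -/
def spatialTensor (S : NonUnitalStarSubalgebra ℂ (H₁ →L[ℂ] H₁))
    (T : NonUnitalStarSubalgebra ℂ (H₂ →L[ℂ] H₂)) :
    NonUnitalStarSubalgebra ℂ (HilbertProd H₁ H₂ →L[ℂ] HilbertProd H₁ H₂) :=
  (NonUnitalStarAlgebra.adjoin ℂ {x | ∃ s ∈ S, ∃ t ∈ T, x = opTensor s t}).topologicalClosure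

theorem isCompactOperator_star {T : H₁ →L[ℂ] H₁} (hT : IsCompactOperator T) :
    IsCompactOperator (star T : H₁ →L[ℂ] H₁) := by
  refine (isCompactOperator_iff_isCompact_closure_image_closedBall
    (star T : H₁ →L[ℂ] H₁).toLinearMap one_pos).2 ?_
  have h1 : IsCompactOperator (T * star T : H₁ →L[ℂ] H₁) := hT.comp_clm (star T : H₁ →L[ℂ] H₁)
  have h2 : TotallyBounded ((T * star T : H₁ →L[ℂ] H₁) '' Metric.closedBall 0 1) :=
    ((isCompactOperator_iff_isCompact_closure_image_closedBall
      (T * star T : H₁ →L[ℂ] H₁).toLinearMap one_pos).1 h1).totallyBounded.subset subset_closure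
  refine isCompact_iff_totallyBounded_isComplete.2
    ⟨TotallyBounded.closure ?_, isClosed_closure.isComplete⟩
  rw [Metric.totallyBounded_iff]
  intro ε hε
  obtain ⟨t, hts, htf, ht⟩ := Metric.finite_approx_of_totallyBounded h2 (ε ^ 2 / 2) (by positivity)
  have hts' : ∀ z ∈ t, ∃ y ∈ Metric.closedBall (0 : H₁) 1, (T * star T : H₁ →L[ℂ] H₁) y = z :=
    fun z hz => hts hz
  choose! y hy hyt using hts'
  refine ⟨(fun z => (star T : H₁ →L[ℂ] H₁) (y z)) '' t, htf.image _, ?_⟩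
  rintro _ ⟨x, hx, rfl⟩
  obtain ⟨z, hz, hxz⟩ := Set.mem_iUnion₂.1 (ht ⟨x, hx, rfl⟩)
  refine Set.mem_iUnion₂.2 ⟨_, ⟨z, hz, rfl⟩, ?_⟩
  rw [Metric.mem_ball, dist_eq_norm] at hxz ⊢
  rw [← hyt z hz, ← map_sub] at hxz
  have h3 : ‖x - y z‖ ≤ 2 := by
    have ha := mem_closedBall_zero_iff.1 hx
    have hb := mem_closedBall_zero_iff.1 (hy z hz)
    linarith [norm_sub_le x (y z)]
  change ‖(star T : H₁ →L[ℂ] H₁) x - (star T : H₁ →L[ℂ] H₁) (y z)‖ < ε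
  rw [← map_sub]
  have h4 : ‖(star T : H₁ →L[ℂ] H₁) (x - y z)‖ ^ 2 ≤ ‖(T * star T : H₁ →L[ℂ] H₁) (x - y z)‖ * ‖x - y z‖ := by
    have h5 : (inner ℂ ((T * star T : H₁ →L[ℂ] H₁) (x - y z)) (x - y z) : ℂ)
        = inner ℂ ((star T : H₁ →L[ℂ] H₁) (x - y z)) ((star T : H₁ →L[ℂ] H₁) (x - y z)) := by
      rw [mul_apply_eq_comp, ContinuousLinearMap.star_eq_adjoint,
        ContinuousLinearMap.adjoint_inner_right]
    calc ‖(star T : H₁ →L[ℂ] H₁) (x - y z)‖ ^ 2 = ‖(inner ℂ ((star T : H₁ →L[ℂ] H₁) (x - y z)) ((star T : H₁ →L[ℂ] H₁) (x - y z)) : ℂ)‖ := by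
          rw [inner_self_eq_norm_sq_to_K]; simp
      _ ≤ _ := by rw [← h5]; exact norm_inner_le_norm _ _
  have h6 : ‖(star T : H₁ →L[ℂ] H₁) (x - y z)‖ ^ 2 < ε ^ 2 := by
    have := norm_nonneg ((T * star T : H₁ →L[ℂ] H₁) (x - y z))
    nlinarith [norm_nonneg (x - y z)]
  exact lt_of_pow_lt_pow_left₀ 2 hε.le h6

variable (H₁) in
/-- `𝓚(H)`: the compact operators on a Hilbert space. -/
def compactOps : NonUnitalStarSubalgebra ℂ (H₁ →L[ℂ] H₁) where
  carrier := {T | IsCompactOperator T}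
  add_mem' := fun h h' => h.add h'
  zero_mem' := isCompactOperator_zero
  smul_mem' := fun z _ h => h.smul z
  mul_mem' := fun {_ b} h _ => h.comp_clm b
  star_mem' := fun h => isCompactOperator_star h

end Spatial

/-! ## Twisted translations and twisted group C⋆-algebras -/

section Twisted

variable {Γ : Type*} [Group Γ]

/-- A normalized 2-cocycle on `Γ` with (constant) values in the circle `S¹`. -/
structure Cocycle (Γ : Type*) [Group Γ] where
  /-- the underlying function -/
  toFun : Γ → Γ → Circle
  cocycle : ∀ a b c : Γ, toFun a b * toFun (a * b) c = toFun a (b * c) * toFun b c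
  normalized : toFun 1 1 = 1

/-- The Hilbert space `ℓ²(Γ)`. -/
abbrev L2 (Γ : Type*) : Type _ := lp (fun _ : Γ => ℂ) 2

/-- The isometric operator `f ↦ (g ↦ u g * f (σ g))` on `ℓ²(Γ)`, for a function `u` with values in
the circle and a permutation `σ` of `Γ`. -/
def weightedShift (u : Γ → Circle) (σ : Γ ≃ Γ) : L2 Γ →ₗᵢ[ℂ] L2 Γ where
  toFun f := ⟨fun g => (u g : ℂ) * f (σ g), by
    have h := (memℓp_gen_iff (p := 2) (by norm_num)).1 (lp.memℓp f)
    refine memℓp_gen ?_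
    simpa [Function.comp_def, Circle.norm_coe] using (σ.summable_iff).2 h⟩
  map_add' f f' := by ext g; exact mul_add _ _ _
  map_smul' z f := by ext g; exact mul_left_comm _ _ _
  norm_map' f := by
    rw [lp.norm_eq_tsum_rpow (by norm_num), lp.norm_eq_tsum_rpow (by norm_num)]
    congr 1
    rw [← σ.tsum_eq (fun g => ‖f g‖ ^ (2 : ENNReal).toReal)]
    refine tsum_congr fun g => ?_
    simp [Circle.norm_coe]

variable (Θ : Cocycle Γ)

/-- The twisted right translation `(R^Θ_γ f)(g) = Θ(g, γ) f(gγ)` on `ℓ²(Γ)`. -/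
def rightTranslation (γ : Γ) : L2 Γ →L[ℂ] L2 Γ :=
  (weightedShift (fun g => Θ.toFun g γ) (Equiv.mulRight γ)).toContinuousLinearMap

theorem rightTranslation_apply (γ : Γ) (f : L2 Γ) (g : Γ) :
    rightTranslation Θ γ f g = (Θ.toFun g γ : ℂ) * f (g * γ) := rfl

/-- The twisted left translation `(L^Θ_γ f)(g) = conj Θ(γ, γ⁻¹g) f(γ⁻¹g)` on `ℓ²(Γ)`. -/
def leftTranslation (γ : Γ) : L2 Γ →L[ℂ] L2 Γ :=
  (weightedShift (fun g => (Θ.toFun γ (γ⁻¹ * g))⁻¹) (Equiv.mulLeft γ⁻¹)).toContinuousLinearMap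

theorem leftTranslation_apply (γ : Γ) (f : L2 Γ) (g : Γ) :
    leftTranslation Θ γ f g
      = (starRingEnd ℂ) (Θ.toFun γ (γ⁻¹ * g) : ℂ) * f (γ⁻¹ * g) := by
  rw [← Circle.coe_inv_eq_conj]
  rfl

/-- The C⋆-algebra of operators on `ℓ²(Γ)` generated by the twisted right translations. -/
def rightAlgebra : StarSubalgebra ℂ (L2 Γ →L[ℂ] L2 Γ) :=
  (StarAlgebra.adjoin ℂ (Set.range (rightTranslation Θ))).topologicalClosure

/-- The C⋆-algebra of operators on `ℓ²(Γ)` generated by the twisted left translations. -/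
def leftAlgebra : StarSubalgebra ℂ (L2 Γ →L[ℂ] L2 Γ) :=
  (StarAlgebra.adjoin ℂ (Set.range (leftTranslation Θ))).topologicalClosure

instance : IsClosed (rightAlgebra Θ : Set (L2 Γ →L[ℂ] L2 Γ)) :=
  StarSubalgebra.isClosed_topologicalClosure _

/-- The reduced twisted group C⋆-algebra `C⋆_r(Γ, Θ)`, generated by the twisted right translations,
as a C⋆-algebra with its usual order. -/
def TwistedAlgebra : Type _ := rightAlgebra Θ

instance : CStarAlgebra (TwistedAlgebra Θ) := inferInstanceAs (CStarAlgebra (rightAlgebra Θ))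
instance : PartialOrder (TwistedAlgebra Θ) := CStarAlgebra.spectralOrder _
instance : StarOrderedRing (TwistedAlgebra Θ) := CStarAlgebra.spectralOrderedRing _

/-- The element `R^Θ_γ` of `C⋆_r(Γ, Θ)`. -/
def TwistedAlgebra.R (γ : Γ) : TwistedAlgebra Θ :=
  (⟨rightTranslation Θ γ, StarSubalgebra.le_topologicalClosure _
    (StarAlgebra.subset_adjoin ℂ _ ⟨γ, rfl⟩)⟩ : rightAlgebra Θ)

end Twisted

end

end GaugePeriodic

namespace GaugePeriodic

noncomputable section

/-! ### The antiunitary flip and the identification of the opposite algebra. -/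

section Flip

variable {Γ : Type*} [Group Γ] (Θ : Cocycle Γ)

/-! The proof has two independent halves.

The opposite algebra. Let `J` be the antiunitary involution `flip`. The cocycle identity gives `J
R_γ J = L_γ` (`flip_rightTranslation_flip`). The map `T ↦ J T⋆ J` is then complex linear, reverses
products, is isometric and is its own inverse, and it exchanges the algebras generated by right and
by left translations. This yields an isometric representation `ρ = opRep` of `Aᵐᵒᵖ` on `ℓ²(Γ)` whose
image is the left algebra. The delta function at the identity is cyclic for it (`denseRange_opRep`).

The compact operators. Let `A` be any unital C⋆-algebra with an isometric representation `ρ` of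
`Aᵐᵒᵖ` on a Hilbert space `K`, cyclic with vector `v`. Each `ξ` in `K` gives a bounded map `c_ξ : a
⊗ f ↦ ρ(a)ξ ⊗ f` from the module to `K ⊗ H`, with `⟪c_ξ x, c_η y⟫ = ⟪ξ, ρ(inner A x y) η⟫`
(`inner_creation`). An adjointable `T` acts on `K ⊗ H` by `c_v x ↦ c_v (T x)`. This is well defined
and bounded by `‖T‖` (`norm_creation_adjointable_le`), and it is isometric because matrix
coefficients on the orbit of `v` recover the norm of the module (`norm_amplifyHom`). On elementary
tensors `π_{a⊗f, b⊗g}` becomes `ρ(a⋆b) ⊗ |g⟩⟨f|` (`amplifyHom_rankOne`). Such operators span a dense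
subspace of the module compacts, and finite rank operators are dense in the compacts on `H`. As the
image of an isometry on a complete space is closed, the image is the whole spatial tensor product.
-/

theorem Cocycle.one_left (c : Γ) : Θ.toFun 1 c = 1 := by
  have h := Θ.cocycle 1 1 c
  rw [one_mul, one_mul, Θ.normalized, one_mul] at h
  exact (mul_eq_left.1 h.symm)

theorem Cocycle.one_right (c : Γ) : Θ.toFun c 1 = 1 := by
  have h := Θ.cocycle c 1 1
  rw [one_mul, mul_one, Θ.normalized, mul_one] at h
  exact (mul_eq_left.1 h)

/-- The cocycle identity at `(g, g⁻¹, g)`. This symmetry makes the phases cancel when `flip` is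
applied twice. -/
theorem Cocycle.inv_comm (g : Γ) : Θ.toFun g⁻¹ g = Θ.toFun g g⁻¹ := by
  have h := Θ.cocycle g g⁻¹ g
  rw [mul_inv_cancel, inv_mul_cancel, Θ.one_left, Θ.one_right, one_mul, mul_one] at h
  exact h.symm

/-- The antiunitary involution `f ↦ (g ↦ Θ(g, g⁻¹) conj f(g⁻¹))` on `ℓ²(Γ)`. -/
def flip : L2 Γ →ₗᵢ⋆[ℂ] L2 Γ :=
  (weightedShift (fun g => Θ.toFun g g⁻¹) (Equiv.inv Γ)).comp
    (starₗᵢ ℂ : L2 Γ ≃ₗᵢ⋆[ℂ] L2 Γ).toLinearIsometry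

theorem flip_apply (f : L2 Γ) (g : Γ) :
    flip Θ f g = (Θ.toFun g g⁻¹ : ℂ) * (starRingEnd ℂ) (f g⁻¹) := rfl

theorem flip_flip (f : L2 Γ) : flip Θ (flip Θ f) = f := by
  ext g
  rw [flip_apply, flip_apply, map_mul, inv_inv, Complex.conj_conj, Θ.inv_comm,
    ← Circle.coe_inv_eq_conj, ← mul_assoc, ← Circle.coe_mul, mul_inv_cancel, Circle.coe_one,
    one_mul]

theorem inner_flip_flip (f f' : L2 Γ) :
    inner ℂ (flip Θ f) (flip Θ f') = (inner ℂ f' f : ℂ) := by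
  rw [lp.inner_eq_tsum, lp.inner_eq_tsum, ← (Equiv.inv Γ).tsum_eq (fun g => inner ℂ (f' g) (f g))]
  refine tsum_congr fun g => ?_
  rw [flip_apply, flip_apply, RCLike.inner_apply, RCLike.inner_apply, map_mul, Complex.conj_conj,
    ← Circle.coe_inv_eq_conj, mul_mul_mul_comm, ← Circle.coe_mul, mul_inv_cancel, Circle.coe_one,
    one_mul, mul_comm]
  rfl

theorem inner_flip_left (f f' : L2 Γ) :
    inner ℂ (flip Θ f) f' = (inner ℂ (flip Θ f') f : ℂ) := by
  conv_lhs => rw [← flip_flip Θ f', inner_flip_flip]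

/-- The conjugation `T ↦ J T⋆ J` by the antiunitary involution `J` of `flip`, as a star homomorphism
on the opposite algebra. -/
def flipHom : (L2 Γ →L[ℂ] L2 Γ)ᵐᵒᵖ →⋆ₐ[ℂ] (L2 Γ →L[ℂ] L2 Γ) where
  toFun T := ((flip Θ).toContinuousLinearMap.comp (star T.unop)).comp
    (flip Θ).toContinuousLinearMap
  map_one' := by
    ext1 f
    exact (congrArg (flip Θ) (by simp)).trans (flip_flip Θ f)
  map_mul' S T := by
    ext1 f
    change flip Θ (star (T.unop * S.unop) (flip Θ f)) =
      flip Θ (star S.unop (flip Θ (flip Θ (star T.unop (flip Θ f)))))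
    rw [flip_flip, star_mul, mul_apply_eq_comp]
  map_zero' := by
    ext1 f
    change flip Θ (star (0 : L2 Γ →L[ℂ] L2 Γ) (flip Θ f)) = 0
    simp
  map_add' S T := by
    ext1 f
    change flip Θ (star (S.unop + T.unop) (flip Θ f)) =
      flip Θ (star S.unop (flip Θ f)) + flip Θ (star T.unop (flip Θ f))
    rw [star_add, add_apply, map_add]
  -- The conjugate linearities of the adjoint and of conjugation by `flip` cancel.
  commutes' z := by
    ext1 f
    change flip Θ (star (algebraMap ℂ (L2 Γ →L[ℂ] L2 Γ) z) (flip Θ f)) = z • f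
    rw [Algebra.algebraMap_eq_smul_one, star_smul, star_one]
    change flip Θ (star z • flip Θ f) = z • f
    rw [LinearIsometry.map_smulₛₗ, flip_flip]
    simp
  map_star' T := by
    refine ContinuousLinearMap.ext fun f => ext_inner_right ℂ fun f' => ?_
    rw [ContinuousLinearMap.star_eq_adjoint (_ ∘SL _), ContinuousLinearMap.adjoint_inner_left]
    change inner ℂ (flip Θ (star (star T.unop) (flip Θ f))) f'
      = (inner ℂ f (flip Θ (star T.unop (flip Θ f'))) : ℂ)
    rw [star_star, inner_flip_left, ← ContinuousLinearMap.adjoint_inner_left,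
      ← ContinuousLinearMap.star_eq_adjoint, ← inner_flip_flip, flip_flip]

theorem flipHom_apply (T : L2 Γ →L[ℂ] L2 Γ) (f : L2 Γ) :
    flipHom Θ (.op T) f = flip Θ (star T (flip Θ f)) := rfl

theorem flipHom_flipHom (T : L2 Γ →L[ℂ] L2 Γ) :
    flipHom Θ (.op (flipHom Θ (.op T))) = T := by
  ext1 f
  rw [flipHom_apply, ← map_star, ← MulOpposite.op_star, flipHom_apply, star_star, flip_flip,
    flip_flip]

theorem flipHom_norm_le (T : (L2 Γ →L[ℂ] L2 Γ)ᵐᵒᵖ) : ‖flipHom Θ T‖ ≤ ‖T‖ := by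
  refine ContinuousLinearMap.opNorm_le_bound _ (norm_nonneg _) fun f => ?_
  rw [← MulOpposite.op_unop T, flipHom_apply, LinearIsometry.norm_map, MulOpposite.norm_op,
    ← norm_star T.unop, ← (flip Θ).norm_map f]
  exact ContinuousLinearMap.le_opNorm _ _

/-- A contraction that is its own inverse is isometric. -/
theorem norm_flipHom_op (T : L2 Γ →L[ℂ] L2 Γ) : ‖flipHom Θ (.op T)‖ = ‖T‖ := by
  refine le_antisymm (flipHom_norm_le Θ _) ?_
  conv_lhs => rw [← flipHom_flipHom Θ T]
  exact flipHom_norm_le Θ _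

theorem continuous_flipHom_op : Continuous fun T : L2 Γ →L[ℂ] L2 Γ => flipHom Θ (.op T) := by
  refine (Isometry.of_dist_eq fun S T => ?_).continuous
  rw [dist_eq_norm, dist_eq_norm, ← map_sub, ← MulOpposite.op_sub, norm_flipHom_op]

theorem flip_rightTranslation_flip (γ : Γ) (f : L2 Γ) :
    flip Θ (rightTranslation Θ γ (flip Θ f)) = leftTranslation Θ γ f := by
  ext g
  rw [flip_apply, rightTranslation_apply, flip_apply, leftTranslation_apply, map_mul, map_mul,
    Complex.conj_conj, ← mul_assoc, ← mul_assoc, mul_inv_rev, inv_inv]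
  congr 1
  simp only [← Circle.coe_inv_eq_conj, ← Circle.coe_mul]
  -- With `inv_comm` this reads `Θ(g⁻¹,γ) Θ(g⁻¹γ,γ⁻¹g) = Θ(g,g⁻¹) Θ(γ,γ⁻¹g)`, which relates all four
  -- phases.
  have h := Θ.cocycle g⁻¹ γ (γ⁻¹ * g)
  rw [mul_inv_cancel_left, Θ.inv_comm] at h
  rw [mul_assoc, ← mul_inv, h]
  simp

theorem flipHom_star_rightTranslation (γ : Γ) :
    flipHom Θ (.op (star (rightTranslation Θ γ))) = leftTranslation Θ γ := by
  ext1 f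
  rw [flipHom_apply, star_star, flip_rightTranslation_flip]

/-- `flipHom` maps the C⋆-algebra generated by a set into each closed star subalgebra that contains
the image of the set. -/
theorem flipHom_mem_of_adjoin {s : Set (L2 Γ →L[ℂ] L2 Γ)}
    {B : StarSubalgebra ℂ (L2 Γ →L[ℂ] L2 Γ)} (hB : IsClosed (B : Set (L2 Γ →L[ℂ] L2 Γ)))
    (hs : ∀ T ∈ s, flipHom Θ (.op T) ∈ B) {T : L2 Γ →L[ℂ] L2 Γ}
    (hT : T ∈ (StarAlgebra.adjoin ℂ s).topologicalClosure) : flipHom Θ (.op T) ∈ B := by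
  have h : (StarAlgebra.adjoin ℂ s : Set (L2 Γ →L[ℂ] L2 Γ))
      ⊆ (fun T => flipHom Θ (.op T)) ⁻¹' B := by
    intro T hT
    change flipHom Θ (.op T) ∈ B
    induction hT using StarAlgebra.adjoin_induction with
    | mem T h => exact hs T h
    | algebraMap z =>
      rw [← MulOpposite.algebraMap_apply, AlgHomClass.commutes]
      exact algebraMap_mem B z
    | add S T _ _ h h' => rw [MulOpposite.op_add, map_add]; exact add_mem h h'
    | mul S T _ _ h h' => rw [MulOpposite.op_mul, map_mul]; exact mul_mem h' h
    | star T _ h => rw [MulOpposite.op_star, map_star]; exact star_mem h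
  exact closure_minimal h (hB.preimage (continuous_flipHom_op Θ)) hT

theorem isClosed_leftAlgebra : IsClosed (leftAlgebra Θ : Set (L2 Γ →L[ℂ] L2 Γ)) :=
  StarSubalgebra.isClosed_topologicalClosure _

theorem isClosed_rightAlgebra : IsClosed (rightAlgebra Θ : Set (L2 Γ →L[ℂ] L2 Γ)) :=
  StarSubalgebra.isClosed_topologicalClosure _

theorem rightTranslation_mem (γ : Γ) : rightTranslation Θ γ ∈ rightAlgebra Θ :=
  StarSubalgebra.le_topologicalClosure _ (StarAlgebra.subset_adjoin ℂ _ ⟨γ, rfl⟩)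

theorem leftTranslation_mem (γ : Γ) : leftTranslation Θ γ ∈ leftAlgebra Θ :=
  StarSubalgebra.le_topologicalClosure _ (StarAlgebra.subset_adjoin ℂ _ ⟨γ, rfl⟩)

theorem flipHom_mem_leftAlgebra {T : L2 Γ →L[ℂ] L2 Γ} (hT : T ∈ rightAlgebra Θ) :
    flipHom Θ (.op T) ∈ leftAlgebra Θ := by
  refine flipHom_mem_of_adjoin Θ (isClosed_leftAlgebra Θ) ?_ hT
  rintro _ ⟨γ, rfl⟩
  rw [← star_star (rightTranslation Θ γ), MulOpposite.op_star, map_star,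
    flipHom_star_rightTranslation]
  exact star_mem (leftTranslation_mem Θ γ)

theorem flipHom_mem_rightAlgebra {T : L2 Γ →L[ℂ] L2 Γ} (hT : T ∈ leftAlgebra Θ) :
    flipHom Θ (.op T) ∈ rightAlgebra Θ := by
  refine flipHom_mem_of_adjoin Θ (isClosed_rightAlgebra Θ) ?_ hT
  rintro _ ⟨γ, rfl⟩
  rw [← flipHom_star_rightTranslation, flipHom_flipHom]
  exact star_mem (rightTranslation_mem Θ γ)

/-- The inclusion of `C⋆_r(Γ, Θ)` into the bounded operators on `ℓ²(Γ)`. -/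
def TwistedAlgebra.incl : TwistedAlgebra Θ →⋆ₐ[ℂ] (L2 Γ →L[ℂ] L2 Γ) := (rightAlgebra Θ).subtype

/-- The representation of the opposite of `C⋆_r(Γ, Θ)` on `ℓ²(Γ)` with image the C⋆-algebra
generated by the twisted left translations. -/
def opRep : (TwistedAlgebra Θ)ᵐᵒᵖ →⋆ₐ[ℂ] (L2 Γ →L[ℂ] L2 Γ) where
  toFun T := flipHom Θ (.op (TwistedAlgebra.incl Θ T.unop))
  map_one' := by simp
  map_mul' S T := by simp
  map_zero' := by simp
  map_add' S T := by simp
  commutes' z := by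
    rw [MulOpposite.algebraMap_apply, MulOpposite.unop_op, AlgHomClass.commutes,
      ← MulOpposite.algebraMap_apply, AlgHomClass.commutes]
  map_star' T := by simp [map_star]

theorem norm_opRep_op (T : TwistedAlgebra Θ) : ‖opRep Θ (.op T)‖ = ‖T‖ :=
  norm_flipHom_op Θ _

theorem opRep_mem (T : (TwistedAlgebra Θ)ᵐᵒᵖ) : opRep Θ T ∈ leftAlgebra Θ :=
  flipHom_mem_leftAlgebra Θ (T := T.unop.1) T.unop.2

theorem opRep_star_R (γ : Γ) :
    opRep Θ (.op (star (TwistedAlgebra.R Θ γ))) = leftTranslation Θ γ :=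
  flipHom_star_rightTranslation Θ γ

/-- Since `flipHom` is an involution that also maps the left algebra into the right one, the
preimage is `flipHom` of `T` itself. -/
theorem exists_opRep_eq {T : L2 Γ →L[ℂ] L2 Γ} (hT : T ∈ leftAlgebra Θ) :
    ∃ a : TwistedAlgebra Θ, opRep Θ (.op a) = T :=
  ⟨(⟨_, flipHom_mem_rightAlgebra Θ hT⟩ : rightAlgebra Θ), flipHom_flipHom Θ T⟩

/-- The opposite of `C⋆_r(Γ, Θ)` is the C⋆-algebra generated by the twisted left translations. -/
def opEquiv : (TwistedAlgebra Θ)ᵐᵒᵖ ≃⋆ₐ[ℂ] leftAlgebra Θ :=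
  StarAlgEquiv.ofBijective ((opRep Θ).codRestrict (leftAlgebra Θ) (opRep_mem Θ)) (by
    constructor
    · refine (injective_iff_map_eq_zero _).2 fun T hT => ?_
      have h := congrArg norm (congrArg Subtype.val hT)
      change ‖opRep Θ (.op T.unop)‖ = ‖(0 : L2 Γ →L[ℂ] L2 Γ)‖ at h
      rw [norm_opRep_op, norm_zero, norm_eq_zero] at h
      exact MulOpposite.unop_injective h
    · rintro ⟨T, hT⟩
      obtain ⟨a, ha⟩ := exists_opRep_eq Θ hT
      exact ⟨.op a, Subtype.ext ha⟩)

/-- The translation `L_γ` sends the delta function at the identity to the one at `γ`, the phase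
being `Θ(γ,1) = 1`. The orbit thus contains all finitely supported functions. -/
theorem denseRange_opRep [DecidableEq Γ] :
    DenseRange fun a : TwistedAlgebra Θ => opRep Θ (.op a) (lp.single 2 (1 : Γ) (1 : ℂ)) := by
  let p : Submodule ℂ (L2 Γ) := LinearMap.range
    (({ toFun := fun a => opRep Θ (.op a) (lp.single 2 (1 : Γ) (1 : ℂ))
        map_add' := fun a b => by simp
        map_smul' := fun z a => by simp } : TwistedAlgebra Θ →ₗ[ℂ] L2 Γ))
  have hp : ∀ γ : Γ, ∀ z : ℂ, lp.single 2 γ z ∈ p := by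
    intro γ z
    refine ⟨z • star (TwistedAlgebra.R Θ γ), ?_⟩
    change opRep Θ (.op (z • star (TwistedAlgebra.R Θ γ))) (lp.single 2 (1 : Γ) (1 : ℂ)) = _
    rw [MulOpposite.op_smul, map_smul, opRep_star_R]
    ext g
    change z • leftTranslation Θ γ (lp.single 2 (1 : Γ) (1 : ℂ)) g = _
    rw [leftTranslation_apply, lp.single_apply, lp.single_apply]
    rcases eq_or_ne g γ with rfl | hg
    · simp [Θ.one_right]
    · have h : γ⁻¹ * g ≠ 1 := fun h => hg (inv_mul_eq_one.1 h).symm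
      simp [hg, h]
  intro f
  exact mem_closure_of_tendsto (lp.hasSum_single (p := 2) (by norm_num) f)
    (.of_forall fun s => p.sum_mem fun γ _ => hp γ (f γ))

end Flip

/-! ### Completeness of the adjointable operators and continuity of `π`. -/

section AdjointableComplete

variable {A E : Type*} [CStarAlgebra A] [PartialOrder A] [StarOrderedRing A]
  [NormedAddCommGroup E] [NormedSpace ℂ E] [SMul A E] [CStarModule A E]

theorem norm_star_adjointable (T : Adjointable A E) : ‖star T‖ = ‖T‖ :=
  le_antisymm (norm_star_le T) (by simpa using norm_star_le (star T))

/-- The adjoint is isometric, so the adjoints of a Cauchy sequence converge too, and their limit is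
an adjoint of the limit. Completeness is what later makes isometric images closed. -/
instance [CompleteSpace E] : CompleteSpace (Adjointable A E) := by
  refine Metric.complete_of_cauchySeq_tendsto fun u hu => ?_
  have h1 : CauchySeq fun n => (u n).1 :=
    hu.map (uniformContinuous_subtype_val (p := (· ∈ adjointableSubalgebra A E)))
  have h2 : CauchySeq fun n => (star (u n)).1 := by
    refine cauchySeq_iff_tendsto_dist_atTop_0.2 ?_
    refine (cauchySeq_iff_tendsto_dist_atTop_0.1 hu).congr fun p => ?_
    change _ = dist (star (u p.1)) (star (u p.2))
    rw [dist_eq_norm, dist_eq_norm, ← star_sub, norm_star_adjointable]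
  obtain ⟨T, hT⟩ := cauchySeq_tendsto_of_complete h1
  obtain ⟨S, hS⟩ := cauchySeq_tendsto_of_complete h2
  have hc : Continuous fun p : E × E => inner A p.1 p.2 := CStarModule.continuous_inner
  have h : ∀ e f : E, inner A (T f) e = inner A f (S e) := fun e f => by
    have h3 := (hc.tendsto _).comp
      (((ContinuousLinearMap.apply ℂ E f).continuous.tendsto T).comp hT |>.prodMk_nhds
        (tendsto_const_nhds (x := e)))
    have h4 := (hc.tendsto _).comp
      ((tendsto_const_nhds (x := f)).prodMk_nhds
        (((ContinuousLinearMap.apply ℂ E e).continuous.tendsto S).comp hS))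
    refine tendsto_nhds_unique h3 (h4.congr fun n => ?_)
    exact (inner_adjointable (u n) e f).symm
  exact ⟨⟨T, S, h⟩, tendsto_subtype_rng.2 hT⟩

theorem norm_rankOne_le (e f : E) : ‖rankOne A e f‖ ≤ ‖e‖ * ‖f‖ := by
  refine ContinuousLinearMap.opNorm_le_bound (rankOneCLM A e f) (by positivity) fun x => ?_
  refine (norm_smul_le' A _ _).trans ?_
  calc ‖(inner A e x : A)‖ * ‖f‖ ≤ (‖e‖ * ‖x‖) * ‖f‖ := by
        gcongr
        exact CStarModule.norm_inner_le E
    _ = ‖e‖ * ‖f‖ * ‖x‖ := by ring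

theorem rankOne_add_left (e e' f : E) :
    rankOne A (e + e') f = rankOne A e f + rankOne A e' f := by
  refine Subtype.ext (ContinuousLinearMap.ext fun x => ext_inner A fun z => ?_)
  change inner A z (inner A (e + e') x • f) = inner A z (inner A e x • f + inner A e' x • f)
  simp [add_mul]

theorem rankOne_add_right (e f f' : E) :
    rankOne A e (f + f') = rankOne A e f + rankOne A e f' := by
  rw [← star_rankOne, rankOne_add_left, star_add, star_rankOne, star_rankOne]

theorem rankOne_smul_left (z : ℂ) (e f : E) :
    rankOne A (z • e) f = star z • rankOne A e f := by
  refine Subtype.ext (ContinuousLinearMap.ext fun x => ext_inner A fun w => ?_)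
  change inner A w (inner A (z • e) x • f) = inner A w (star z • (inner A e x • f))
  simp

theorem rankOne_smul_right (z : ℂ) (e f : E) :
    rankOne A e (z • f) = z • rankOne A e f := by
  rw [← star_rankOne, rankOne_smul_left, star_smul, star_rankOne, star_star]

variable (A E) in
/-- The operators `π_{e,f}`, as a sesquilinear map. -/
def rankOneSL : E →L⋆[ℂ] E →L[ℂ] Adjointable A E :=
  LinearMap.mkContinuous₂ (LinearMap.mk₂'ₛₗ (starRingEnd ℂ) (RingHom.id ℂ) (rankOne A)
    rankOne_add_left rankOne_smul_left rankOne_add_right rankOne_smul_right) 1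
    fun e f => by rw [one_mul]; exact norm_rankOne_le e f

theorem rankOneSL_apply (e f : E) : rankOneSL A E e f = rankOne A e f := rfl

theorem continuous_rankOne : Continuous fun p : E × E => rankOne A p.1 p.2 := by
  simp_rw [← rankOneSL_apply]
  fun_prop

end AdjointableComplete

/-! ### Vectors of `K` as bounded maps from the module to `K ⊗ H`. -/

section Amplification

/-- The embedding of the algebraic tensor product into the Hilbert space tensor product. -/
def HilbertProd.ofTensor {K H : Type*} [NormedAddCommGroup K] [InnerProductSpace ℂ K]
    [NormedAddCommGroup H] [InnerProductSpace ℂ H] : K ⊗[ℂ] H →L[ℂ] HilbertProd K H :=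
  UniformSpace.Completion.toComplL

theorem HilbertProd.denseRange_ofTensor {K H : Type*} [NormedAddCommGroup K]
    [InnerProductSpace ℂ K] [NormedAddCommGroup H] [InnerProductSpace ℂ H] :
    DenseRange (HilbertProd.ofTensor (K := K) (H := H)) :=
  UniformSpace.Completion.denseRange_coe

theorem HilbertProd.inner_ofTensor {K H : Type*} [NormedAddCommGroup K]
    [InnerProductSpace ℂ K] [NormedAddCommGroup H] [InnerProductSpace ℂ H] (s t : K ⊗[ℂ] H) :
    inner ℂ (HilbertProd.ofTensor s) (HilbertProd.ofTensor t) = (inner ℂ s t : ℂ) :=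
  UniformSpace.Completion.inner_coe s t

theorem norm_sq_eq_norm_inner {F : Type*} [NormedAddCommGroup F] [InnerProductSpace ℂ F] (x : F) :
    ‖x‖ ^ 2 = ‖(inner ℂ x x : ℂ)‖ := by
  rw [inner_self_eq_norm_sq_to_K]
  simp

/-- For `c > 0`, iteration gives `(u 0 / c) ^ 2 ^ n ≤ u n / c ≤ (C / c) * M ^ 2 ^ n`; taking roots
of order `2 ^ n` removes the constant `C / c`. Used to improve a crude bound on the iterates of a
self-adjoint operator to a sharp one. -/
theorem le_of_sq_le_mul_iterate {c M C : ℝ} (hM : 0 ≤ M) {u : ℕ → ℝ} (hc : 0 ≤ c)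
    (hu : ∀ n, 0 ≤ u n) (h : ∀ n, u n ^ 2 ≤ c * u (n + 1)) (hb : ∀ n, u n ≤ C * M ^ (2 ^ n)) :
    u 0 ≤ M * c := by
  -- Stated without division, so that it also covers `c = 0`.
  have h1 : ∀ n, c * u 0 ^ 2 ^ n ≤ c ^ 2 ^ n * u n := by
    intro n
    induction n with
    | zero => simp
    | succ n ih =>
      rcases hc.eq_or_lt with rfl | hc
      · simp
      · refine le_of_mul_le_mul_left ?_ hc
        calc c * (c * u 0 ^ 2 ^ (n + 1)) = (c * u 0 ^ 2 ^ n) ^ 2 := by rw [pow_succ 2 n]; ring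
          _ ≤ (c ^ 2 ^ n * u n) ^ 2 := by
            have := hu 0
            gcongr
          _ = (c ^ 2 ^ n) ^ 2 * u n ^ 2 := by ring
          _ ≤ (c ^ 2 ^ n) ^ 2 * (c * u (n + 1)) := by gcongr; exact h n
          _ = _ := by rw [pow_succ 2 n]; ring
  by_contra! hlt
  have hc' : 0 < c := hc.lt_of_ne (by
    rintro rfl
    have := h 0
    nlinarith)
  have hM' : 0 < M := hM.lt_of_ne (by
    rintro rfl
    have := hb 0
    simp at this
    nlinarith)
  have hr : 1 < u 0 / (M * c) := (one_lt_div (by positivity)).2 hlt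
  obtain ⟨m, hm⟩ := pow_unbounded_of_one_lt (C / c) hr
  have h2 : (u 0 / (M * c)) ^ 2 ^ m ≤ C / c := by
    rw [div_pow, div_le_div_iff₀ (by positivity) hc']
    calc u 0 ^ 2 ^ m * c = c * u 0 ^ 2 ^ m := mul_comm _ _
      _ ≤ c ^ 2 ^ m * u m := h1 m
      _ ≤ c ^ 2 ^ m * (C * M ^ 2 ^ m) := by gcongr; exact hb m
      _ = C * (M * c) ^ 2 ^ m := by rw [mul_pow]; ring
  exact (hm.trans_le (pow_le_pow_right₀ hr.le Nat.lt_two_pow_self.le)).not_ge h2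

variable {A H K : Type*} [CStarAlgebra A] [PartialOrder A] [StarOrderedRing A]
  [NormedAddCommGroup H] [InnerProductSpace ℂ H]
  [NormedAddCommGroup K] [InnerProductSpace ℂ K] [CompleteSpace K]
  (ρ : Aᵐᵒᵖ →⋆ₐ[ℂ] (K →L[ℂ] K))

/-- The linear map `a ⊗ f ↦ ρ(a) ξ ⊗ f` on the algebraic tensor product. -/
def evalTensor (ξ : K) : A ⊗[ℂ] H →ₗ[ℂ] K ⊗[ℂ] H :=
  TensorProduct.map
    { toFun := fun a => ρ (.op a) ξ
      map_add' := fun a b => by simp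
      map_smul' := fun z a => by simp } .id

theorem evalTensor_tmul (ξ : K) (a : A) (f : H) :
    evalTensor ρ ξ (a ⊗ₜ f) = (ρ (.op a) ξ) ⊗ₜ f := rfl

/-- On elementary tensors `b * star a` is sent by `ρ` to `ρ(a)⋆ ρ(b)`, because `ρ` reverses products
of `A`. This is why the opposite algebra matches a left module. -/
theorem inner_evalTensor (ξ η : K) (x y : A ⊗[ℂ] H) :
    inner ℂ (evalTensor ρ ξ x) (evalTensor ρ η y)
      = (inner ℂ ξ (ρ (.op (preInner A H x y)) η) : ℂ) := by
  induction x with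
  | zero => simp
  | add x x' h h' =>
    rw [map_add, inner_add_left, h, h', map_add, LinearMap.add_apply, MulOpposite.op_add, map_add,
      add_apply, inner_add_right]
  | tmul a f =>
    induction y with
    | zero => simp
    | add y y' h h' =>
      rw [map_add, inner_add_right, h, h', map_add, MulOpposite.op_add, map_add,
        add_apply, inner_add_right]
    | tmul b g =>
      rw [preInner_tmul, evalTensor_tmul, evalTensor_tmul, TensorProduct.inner_tmul,
        MulOpposite.op_smul, map_smul,
        MulOpposite.op_mul, map_mul, MulOpposite.op_star, map_star, smul_apply,
        mul_apply_eq_comp, inner_smul_right, ContinuousLinearMap.star_eq_adjoint,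
        ContinuousLinearMap.adjoint_inner_right, mul_comm]

theorem evalTensor_smul (ξ : K) (a : A) (x : A ⊗[ℂ] H) :
    evalTensor ρ ξ (a • x) = evalTensor ρ (ρ (.op a) ξ) x := by
  induction x with
  | zero => simp
  | add x x' h h' => rw [smul_add, map_add, map_add, h, h']
  | tmul b f =>
    rw [TensorProduct.smul_tmul', evalTensor_tmul, evalTensor_tmul, smul_eq_mul, MulOpposite.op_mul,
      map_mul, mul_apply_eq_comp]

variable {ρ} (hρ : ∀ a : A, ‖ρ (.op a)‖ = ‖a‖)

include hρ in
theorem norm_sq_evalTensor_le (ξ : K) (x : A ⊗[ℂ] H) :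
    ‖evalTensor ρ ξ x‖ ^ 2 ≤ ‖ξ‖ ^ 2 * ‖preInner A H x x‖ := by
  rw [norm_sq_eq_norm_inner, inner_evalTensor]
  refine (norm_inner_le_norm _ _).trans ?_
  calc ‖ξ‖ * ‖ρ (.op (preInner A H x x)) ξ‖ ≤ ‖ξ‖ * (‖ρ (.op (preInner A H x x))‖ * ‖ξ‖) := by
        gcongr
        exact ContinuousLinearMap.le_opNorm _ _
    _ = _ := by rw [hρ]; ring

include hρ in
theorem norm_evalTensor_le (ξ : K) (x : PreTensor A H) : ‖evalTensor ρ ξ x‖ ≤ ‖ξ‖ * ‖x‖ := by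
  refine le_of_sq_le_sq ((norm_sq_evalTensor_le hρ ξ x).trans_eq ?_) (by positivity)
  rw [mul_pow, CStarModule.norm_sq_eq A (x := x)]
  rfl

/-- The bounded operator `a ⊗ f ↦ ρ(a) ξ ⊗ f` on the Hilbert module `A ⊗ H`. -/
def creation (ξ : K) : HilbertTensor A H →L[ℂ] HilbertProd K H :=
  ContinuousLinearMap.completion (α := PreTensor A H) (β := K ⊗[ℂ] H)
    (LinearMap.mkContinuous (E := PreTensor A H) (σ := RingHom.id ℂ)
      { toFun := evalTensor ρ ξ
        map_add' := (evalTensor ρ ξ).map_add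
        map_smul' := (evalTensor ρ ξ).map_smul } ‖ξ‖ (norm_evalTensor_le hρ ξ))

theorem creation_coe (ξ : K) (x : PreTensor A H) :
    creation hρ ξ ((x : UniformSpace.Completion (PreTensor A H)) : HilbertTensor A H)
      = HilbertProd.ofTensor (evalTensor ρ ξ x) :=
  ContinuousLinearMap.completion_apply_coe _ x

theorem continuous_inner_hilbertTensor :
    Continuous fun p : HilbertTensor A H × HilbertTensor A H => inner A p.1 p.2 :=
  CStarModule.continuous_inner

theorem inner_creation (ξ η : K) (x y : HilbertTensor A H) :
    inner ℂ (creation hρ ξ x) (creation hρ η y)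
      = (inner ℂ ξ (ρ (.op (inner A x y)) η) : ℂ) := by
  have hc : Continuous fun a : A => ρ (.op a) η := by
    refine (LipschitzWith.of_dist_le_mul (K := ‖η‖₊) fun a b => ?_).continuous
    rw [dist_eq_norm, dist_eq_norm, ← sub_apply, ← map_sub, ← MulOpposite.op_sub, ← hρ, coe_nnnorm,
      mul_comm]
    exact ContinuousLinearMap.le_opNorm _ _
  refine UniformSpace.Completion.induction_on₂ (α := PreTensor A H) (β := PreTensor A H) x y
    (isClosed_eq (((creation hρ ξ).continuous.comp continuous_fst).inner
      ((creation hρ η).continuous.comp continuous_snd))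
      (continuous_const.inner (hc.comp continuous_inner_hilbertTensor))) fun a b => ?_
  rw [creation_coe, creation_coe]
  refine (HilbertProd.inner_ofTensor _ _).trans ((inner_evalTensor ρ ξ η _ _).trans ?_)
  have h : (inner A (a : UniformSpace.Completion (PreTensor A H))
      (b : UniformSpace.Completion (PreTensor A H)) : A) = preInner A H a b :=
    completion_inner_coe a b
  exact congrArg (fun c => (inner ℂ ξ (ρ (.op c) η) : ℂ)) h.symm

theorem norm_sq_creation (ξ : K) (x : HilbertTensor A H) :
    ‖creation hρ ξ x‖ ^ 2 = ‖(inner ℂ ξ (ρ (.op (inner A x x)) ξ) : ℂ)‖ := by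
  rw [← inner_creation hρ, norm_sq_eq_norm_inner]

theorem creation_smul (ξ : K) (a : A) (x : HilbertTensor A H) :
    creation hρ ξ (a • x) = creation hρ (ρ (.op a) ξ) x := by
  refine UniformSpace.Completion.induction_on (α := PreTensor A H) x
    (isClosed_eq ((creation hρ ξ).continuous.comp
      ((uniformContinuousConstSMul A (HilbertTensor A H)).uniformContinuous_const_smul a).continuous)
      (creation hρ _).continuous) fun b => ?_
  have h : (a • (b : UniformSpace.Completion (PreTensor A H)))
    = ((a • b : PreTensor A H) : UniformSpace.Completion (PreTensor A H)) :=
    (UniformSpace.Completion.coe_smul a b).symm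
  refine (congrArg (creation hρ ξ) h).trans ?_
  rw [creation_coe, creation_coe]
  exact congrArg _ (evalTensor_smul ρ ξ a b)

theorem creation_tmul (ξ : K) (a : A) (f : H) :
    creation hρ ξ (tmul a f)
      = HilbertProd.ofTensor ((ρ (.op a) ξ) ⊗ₜ f) :=
  creation_coe hρ ξ _

omit [CompleteSpace K] in
theorem dense_span_coe_tmul {D : Set K} (hD : Dense D) :
    Dense (Submodule.span ℂ {x : HilbertProd K H | ∃ ξ ∈ D, ∃ f : H,
      x = HilbertProd.ofTensor (ξ ⊗ₜ f)} : Set (HilbertProd K H)) := by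
  set p := Submodule.span ℂ {x : HilbertProd K H | ∃ ξ ∈ D, ∃ f : H,
      x = HilbertProd.ofTensor (ξ ⊗ₜ f)} with hp
  have hc : ∀ t : K ⊗[ℂ] H,
      HilbertProd.ofTensor t ∈ p.topologicalClosure := by
    intro t
    induction t with
    | zero => rw [map_zero]; exact zero_mem _
    | add s t hs ht =>
      rw [map_add]
      exact add_mem hs ht
    | tmul ξ f =>
      have h : Continuous fun ξ : K =>
          HilbertProd.ofTensor (ξ ⊗ₜ f) :=
        HilbertProd.ofTensor.continuous.comp (by fun_prop)
      exact map_mem_closure (t := (p : Set (HilbertProd K H)))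
        (f := fun ξ : K => HilbertProd.ofTensor (ξ ⊗ₜ f)) h (hD ξ) fun η hη =>
        Submodule.subset_span ⟨η, hη, f, rfl⟩
  intro x
  exact p.isClosed_topologicalClosure.closure_subset_iff.2 (Set.range_subset_iff.2 hc)
    (HilbertProd.denseRange_ofTensor x)

theorem denseRange_creation {v : K} (hv : DenseRange fun a : A => ρ (.op a) v) :
    DenseRange (creation (H := H) hρ v) := by
  have h := Submodule.span_le (s := {x : HilbertProd K H |
    ∃ ξ ∈ Set.range fun a : A => ρ (.op a) v, ∃ f : H, x = HilbertProd.ofTensor (ξ ⊗ₜ f)})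
    (p := LinearMap.range (creation (H := H) hρ v).toLinearMap)
  refine (dense_span_coe_tmul (H := H) hv).mono (h.2 ?_)
  rintro _ ⟨_, ⟨a, rfl⟩, f, rfl⟩
  exact ⟨tmul a f, creation_tmul hρ v a f⟩

theorem inner_creation_adjointable (ξ η : K) (T : Adjointable A (HilbertTensor A H))
    (x y : HilbertTensor A H) :
    inner ℂ (creation hρ ξ (T.1 x)) (creation hρ η y)
      = (inner ℂ (creation hρ ξ x) (creation hρ η ((star T).1 y)) : ℂ) := by
  rw [inner_creation, inner_creation, inner_adjointable]

theorem norm_sq_creation_le (ξ : K) (T : Adjointable A (HilbertTensor A H))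
    (x : HilbertTensor A H) :
    ‖creation hρ ξ (T.1 x)‖ ^ 2 ≤ ‖creation hρ ξ x‖ * ‖creation hρ ξ ((star T * T).1 x)‖ := by
  rw [norm_sq_eq_norm_inner, inner_creation_adjointable]
  exact norm_inner_le_norm _ _

/-- Continuity of `T` in the module norm does not suffice, since `‖creation hρ ξ x‖` may be far
smaller than `‖x‖`. For `S = T⋆T`, Cauchy–Schwarz bounds `‖c_ξ S^(2^n) x‖²` by `‖c_ξ x‖ ‖c_ξ
S^(2^(n+1)) x‖`, and `le_of_sq_le_mul_iterate` applies. This plays the role of the inequality `T⋆T ≤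
‖T‖²`. -/
theorem norm_creation_adjointable_le (ξ : K) (T : Adjointable A (HilbertTensor A H))
    (x : HilbertTensor A H) : ‖creation hρ ξ (T.1 x)‖ ≤ ‖T‖ * ‖creation hρ ξ x‖ := by
  set S := star T * T with hS
  have hSs : star S = S := by rw [hS, star_mul, star_star]
  have h1 : ‖creation hρ ξ (S.1 x)‖ ≤ ‖S‖ * ‖creation hρ ξ x‖ := by
    refine (le_of_eq ?_).trans (le_of_sq_le_mul_iterate (c := ‖creation hρ ξ x‖) (M := ‖S‖)
      (C := ‖creation (H := H) hρ ξ‖ * ‖x‖) (u := fun n => ‖creation hρ ξ ((S ^ 2 ^ n).1 x)‖)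
      (norm_nonneg _) (norm_nonneg _) (fun n => norm_nonneg _) (fun n => ?_) fun n => ?_)
    · simp
    · have h := norm_sq_creation_le hρ ξ (S ^ 2 ^ n) x
      rwa [star_pow, hSs, ← pow_add, ← two_mul, ← pow_succ'] at h
    · calc ‖creation hρ ξ ((S ^ 2 ^ n).1 x)‖
          ≤ ‖creation (H := H) hρ ξ‖ * (‖S ^ 2 ^ n‖ * ‖x‖) :=
            (ContinuousLinearMap.le_opNorm _ _).trans (by
              gcongr
              exact ContinuousLinearMap.le_opNorm _ _)
        _ ≤ ‖creation (H := H) hρ ξ‖ * (‖S‖ ^ 2 ^ n * ‖x‖) := by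
            gcongr
            exact norm_pow_le' _ (by positivity)
        _ = _ := by ring
  refine le_of_sq_le_sq ((norm_sq_creation_le hρ ξ T x).trans ?_) (by positivity)
  have h2 : ‖S‖ ≤ ‖T‖ ^ 2 := by
    refine (norm_mul_le _ _).trans ?_
    rw [norm_star_adjointable, sq]
  calc _ ≤ ‖creation hρ ξ x‖ * (‖T‖ ^ 2 * ‖creation hρ ξ x‖) := by
        gcongr
        exact h1.trans (by gcongr)
    _ = _ := by ring

end Amplification

/-! ### The isometric representation of adjointable operators on `K ⊗ H`. -/

section Amplify

variable {A H K : Type*} [CStarAlgebra A] [PartialOrder A] [StarOrderedRing A]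
  [NormedAddCommGroup H] [InnerProductSpace ℂ H]
  [NormedAddCommGroup K] [InnerProductSpace ℂ K] [CompleteSpace K]
  {ρ : Aᵐᵒᵖ →⋆ₐ[ℂ] (K →L[ℂ] K)} (hρ : ∀ a : A, ‖ρ (.op a)‖ = ‖a‖)
  {v : K} (hv : DenseRange fun a : A => ρ (.op a) v)

/-- The operator on the Hilbert space tensor product induced by an adjointable operator on
`A ⊗ H`, for a cyclic vector `v` of the representation `ρ`. -/
def amplify (v : K) (T : Adjointable A (HilbertTensor A H)) :
    HilbertProd K H →L[ℂ] HilbertProd K H :=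
  ((creation hρ v ∘L T.1).toLinearMap).extendOfNorm (creation hρ v).toLinearMap

include hv in
theorem amplify_creation (T : Adjointable A (HilbertTensor A H)) (x : HilbertTensor A H) :
    amplify hρ v T (creation hρ v x) = creation hρ v (T.1 x) :=
  LinearMap.extendOfNorm_eq (denseRange_creation hρ hv)
    ⟨‖T‖, norm_creation_adjointable_le hρ v T⟩ x

include hv in
theorem norm_amplify_le (T : Adjointable A (HilbertTensor A H)) : ‖amplify hρ v T‖ ≤ ‖T‖ :=
  LinearMap.opNorm_extendOfNorm_le (denseRange_creation hρ hv) (norm_nonneg _)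
    (norm_creation_adjointable_le hρ v T)

include hv in
theorem ext_creation {S T : HilbertProd K H →L[ℂ] HilbertProd K H}
    (h : ∀ x, S (creation hρ v x) = T (creation hρ v x)) : S = T :=
  ContinuousLinearMap.ext fun z => congrFun ((denseRange_creation hρ hv).equalizer S.continuous
    T.continuous (funext h)) z

/-- `amplify` as a star homomorphism. -/
def amplifyHom : Adjointable A (HilbertTensor A H) →⋆ₙₐ[ℂ]
    (HilbertProd K H →L[ℂ] HilbertProd K H) where
  toFun := amplify hρ v
  map_smul' z T := ext_creation hρ hv fun x => by
    rw [smul_apply, amplify_creation hρ hv, amplify_creation hρ hv]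
    exact map_smul (creation hρ v) z (T.1 x)
  map_zero' := ext_creation hρ hv fun x => by
    rw [amplify_creation hρ hv]
    exact map_zero (creation hρ v)
  map_add' S T := ext_creation hρ hv fun x => by
    rw [add_apply, amplify_creation hρ hv, amplify_creation hρ hv, amplify_creation hρ hv]
    exact map_add (creation hρ v) (S.1 x) (T.1 x)
  map_mul' S T := ext_creation hρ hv fun x => by
    rw [mul_apply_eq_comp, amplify_creation hρ hv, amplify_creation hρ hv, amplify_creation hρ hv]
    rfl
  map_star' T := ext_creation hρ hv fun x => by
    refine (denseRange_creation hρ hv).eq_of_inner_left ℂ fun y => ?_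
    rw [amplify_creation hρ hv, ContinuousLinearMap.star_eq_adjoint,
      ContinuousLinearMap.adjoint_inner_left, amplify_creation hρ hv, inner_creation_adjointable,
      star_star]

theorem amplifyHom_creation (T : Adjointable A (HilbertTensor A H)) (x : HilbertTensor A H) :
    amplifyHom hρ hv T (creation hρ v x) = creation hρ v (T.1 x) := amplify_creation hρ hv T x

theorem map_smul_adjointable (T : Adjointable A (HilbertTensor A H)) (a : A)
    (x : HilbertTensor A H) : T.1 (a • x) = a • T.1 x := by
  refine ext_inner A fun z => ?_
  rw [← inner_adjointable', CStarModule.inner_op_smul_right, CStarModule.inner_op_smul_right,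
    inner_adjointable']

/-- The operator is built from `v` alone, but `T` is `A`-linear, so it intertwines the maps of the
whole orbit of `v`. The lower norm bound needs this. -/
theorem amplifyHom_creation_rep (T : Adjointable A (HilbertTensor A H)) (a : A)
    (x : HilbertTensor A H) :
    amplifyHom hρ hv T (creation hρ (ρ (.op a) v) x) = creation hρ (ρ (.op a) v) (T.1 x) := by
  rw [← creation_smul, amplifyHom_creation, map_smul_adjointable, creation_smul]

omit [CompleteSpace K] in
theorem norm_le_of_dense_inner_le {D : Set K} (hD : Dense D) {B : K →L[ℂ] K} {C : ℝ} (hC : 0 ≤ C)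
    (h : ∀ ξ ∈ D, ∀ η ∈ D, ‖(inner ℂ ξ (B η) : ℂ)‖ ≤ C * (‖ξ‖ * ‖η‖)) : ‖B‖ ≤ C := by
  have h1 : ∀ p : K × K, ‖(inner ℂ p.1 (B p.2) : ℂ)‖ ≤ C * (‖p.1‖ * ‖p.2‖) := fun p =>
    (isClosed_le (f := fun p : K × K => ‖(inner ℂ p.1 (B p.2) : ℂ)‖)
      (g := fun p : K × K => C * (‖p.1‖ * ‖p.2‖)) (by fun_prop) (by fun_prop)).closure_subset_iff.2
      (fun p hp => h p.1 hp.1 p.2 hp.2) ((hD.prod hD) p)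
  refine ContinuousLinearMap.opNorm_le_of_re_inner_le hC fun x y hx hy => ?_
  refine (RCLike.re_le_norm _).trans ?_
  rw [← norm_inner_symm]
  simpa [hx, hy] using h1 (y, x)

theorem norm_creation_le (ξ : K) (x : HilbertTensor A H) :
    ‖creation hρ ξ x‖ ≤ ‖ξ‖ * ‖x‖ := by
  refine le_of_sq_le_sq ?_ (by positivity)
  rw [norm_sq_creation, mul_pow, CStarModule.norm_sq_eq A (x := x), ← hρ]
  refine (norm_inner_le_norm _ _).trans ?_
  calc _ ≤ ‖ξ‖ * (‖ρ (.op (inner A x x))‖ * ‖ξ‖) := by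
        gcongr
        exact ContinuousLinearMap.le_opNorm _ _
    _ = _ := by ring

/-- For the lower bound, `‖T x‖²` is the norm of `ρ(inner A (T x) (T x))`, which can be tested on
the dense orbit of `v`. There its matrix coefficients are scalar products of vectors `c_ξ (T x)`,
each the image of `c_ξ x` under the amplified operator. -/
theorem norm_amplifyHom (T : Adjointable A (HilbertTensor A H)) : ‖amplifyHom hρ hv T‖ = ‖T‖ := by
  refine le_antisymm (norm_amplify_le hρ hv T) ?_
  refine ContinuousLinearMap.opNorm_le_bound T.1 (norm_nonneg _) fun x => ?_
  refine le_of_sq_le_sq ?_ (by positivity)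
  rw [CStarModule.norm_sq_eq A (x := T.1 x), ← hρ]
  refine norm_le_of_dense_inner_le hv (by positivity) ?_
  have hb : ∀ a : A, ‖creation hρ (ρ (.op a) v) (T.1 x)‖
      ≤ ‖amplifyHom hρ hv T‖ * (‖ρ (.op a) v‖ * ‖x‖) := fun a => by
    rw [← amplifyHom_creation_rep hρ hv]
    refine (ContinuousLinearMap.le_opNorm _ _).trans ?_
    gcongr
    exact norm_creation_le hρ _ _
  rintro _ ⟨a, rfl⟩ _ ⟨b, rfl⟩
  rw [← inner_creation hρ]
  refine (norm_inner_le_norm _ _).trans ((mul_le_mul (hb a) (hb b) (norm_nonneg _)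
    (by positivity)).trans_eq ?_)
  ring

theorem isometry_amplifyHom : Isometry (amplifyHom (H := H) hρ hv) := by
  refine Isometry.of_dist_eq fun S T => ?_
  rw [dist_eq_norm, dist_eq_norm, ← map_sub, norm_amplifyHom]

theorem isClosed_image_compacts :
    IsClosed (amplifyHom hρ hv '' (compacts A (HilbertTensor A H) :
      Set (Adjointable A (HilbertTensor A H)))) := by
  refine IsComplete.isClosed ?_
  refine ((isometry_amplifyHom hρ hv).isUniformInducing.isComplete_iff).2 ?_
  exact (isClosed_closure (s := (finiteOperators A (HilbertTensor A H) :
    Set (Adjointable A (HilbertTensor A H))))).isComplete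

end Amplify

/-! ### Norm bound and linearity for elementary tensors of operators. -/

section OperatorTensor

variable {H K : Type*} [NormedAddCommGroup H] [InnerProductSpace ℂ H]
  [NormedAddCommGroup K] [InnerProductSpace ℂ K]

theorem opTensor_ofTensor (s : K →L[ℂ] K) (t : H →L[ℂ] H) (z : K ⊗[ℂ] H) :
    opTensor s t (HilbertProd.ofTensor z) = HilbertProd.ofTensor (TensorProduct.mapL s t z) :=
  ContinuousLinearMap.completion_apply_coe _ z

theorem ext_ofTensor {S T : HilbertProd K H →L[ℂ] HilbertProd K H}
    (h : ∀ z, S (HilbertProd.ofTensor z) = T (HilbertProd.ofTensor z)) : S = T :=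
  ContinuousLinearMap.ext fun z => congrFun (HilbertProd.denseRange_ofTensor.equalizer S.continuous
    T.continuous (funext h)) z

theorem norm_ofTensor (z : K ⊗[ℂ] H) : ‖HilbertProd.ofTensor z‖ = ‖z‖ :=
  UniformSpace.Completion.norm_coe z

theorem norm_opTensor_le (s : K →L[ℂ] K) (t : H →L[ℂ] H) : ‖opTensor s t‖ ≤ ‖s‖ * ‖t‖ := by
  refine ContinuousLinearMap.opNorm_le_bound _ (by positivity) fun z => ?_
  have hc : IsClosed {z | ‖opTensor s t z‖ ≤ ‖s‖ * ‖t‖ * ‖z‖} :=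
    isClosed_le (by fun_prop) (by fun_prop)
  refine hc.closure_subset_iff.2 (Set.range_subset_iff.2 fun z => ?_)
    (HilbertProd.denseRange_ofTensor z)
  change ‖opTensor s t _‖ ≤ _
  rw [opTensor_ofTensor, norm_ofTensor, norm_ofTensor]
  exact (ContinuousLinearMap.le_opNorm _ _).trans (by
    gcongr
    exact TensorProduct.norm_mapL_le s t)

theorem opTensor_sub_right (s : K →L[ℂ] K) (t t' : H →L[ℂ] H) :
    opTensor s (t - t') = opTensor s t - opTensor s t' :=
  ext_ofTensor fun z => by
    rw [sub_apply, opTensor_ofTensor, opTensor_ofTensor, opTensor_ofTensor, ← map_sub,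
      sub_eq_add_neg, ← neg_one_smul ℂ t', TensorProduct.mapL_add_right,
      TensorProduct.mapL_smul_right, add_apply, smul_apply, neg_one_smul, sub_eq_add_neg]

theorem continuous_opTensor_right (s : K →L[ℂ] K) :
    Continuous fun t : H →L[ℂ] H => opTensor s t := by
  refine (LipschitzWith.of_dist_le_mul (K := ‖s‖₊) fun t t' => ?_).continuous
  rw [dist_eq_norm, dist_eq_norm, ← opTensor_sub_right]
  exact norm_opTensor_le _ _

theorem opTensor_add_right (s : K →L[ℂ] K) (t t' : H →L[ℂ] H) :
    opTensor s (t + t') = opTensor s t + opTensor s t' :=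
  ext_ofTensor fun z => by
    rw [add_apply, opTensor_ofTensor, opTensor_ofTensor, opTensor_ofTensor, ← map_add,
      TensorProduct.mapL_add_right, add_apply]

theorem opTensor_smul_right (s : K →L[ℂ] K) (c : ℂ) (t : H →L[ℂ] H) :
    opTensor s (c • t) = c • opTensor s t :=
  ext_ofTensor fun z => by
    rw [smul_apply, opTensor_ofTensor, opTensor_ofTensor, ← map_smul,
      TensorProduct.mapL_smul_right, smul_apply]

end OperatorTensor

/-! ### The image of the module compacts is the spatial tensor product. -/

section Range

variable {A H K : Type*} [CStarAlgebra A] [PartialOrder A] [StarOrderedRing A]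
  [NormedAddCommGroup H] [InnerProductSpace ℂ H]
  [NormedAddCommGroup K] [InnerProductSpace ℂ K] [CompleteSpace K]
  {ρ : Aᵐᵒᵖ →⋆ₐ[ℂ] (K →L[ℂ] K)} (hρ : ∀ a : A, ‖ρ (.op a)‖ = ‖a‖)
  {v : K} (hv : DenseRange fun a : A => ρ (.op a) v)

/-- The operator `π` sends `c ⊗ h` to `⟪f, h⟫ • (c a⋆ b ⊗ g)`, and `ρ(c a⋆ b) v = ρ(a⋆ b) ρ(c) v` by
reversal of products. The vectors `ρ(c) v ⊗ h` are total. -/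
theorem amplifyHom_rankOne (a b : A) (f g : H) :
    amplifyHom hρ hv (rankOne A (tmul a f) (tmul b g))
      = opTensor (ρ (.op (star a * b))) (InnerProductSpace.rankOne ℂ g f) := by
  refine ContinuousLinearMap.ext_on (dense_span_coe_tmul (H := H) hv) ?_
  rintro _ ⟨_, ⟨c, rfl⟩, h, rfl⟩
  change amplifyHom hρ hv _ (HilbertProd.ofTensor (ρ (.op c) v ⊗ₜ h)) = _
  rw [← creation_tmul hρ, amplifyHom_creation]
  change creation hρ v ((inner A (tmul a f) (tmul c h) : A) • tmul b g) = _
  rw [creation_smul, creation_tmul, creation_tmul, opTensor_ofTensor, TensorProduct.mapL_tmul,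
    inner_tmul, InnerProductSpace.rankOne_apply, TensorProduct.tmul_smul,
    TensorProduct.smul_tmul']
  simp

variable [CompleteSpace H]

theorem starProjection_mul_mem_span (V : Submodule ℂ H) [FiniteDimensional ℂ V] (T : H →L[ℂ] H) :
    V.starProjection * T ∈ Submodule.span ℂ
      {t | ∃ f g : H, t = InnerProductSpace.rankOne ℂ g f} := by
  rw [(stdOrthonormalBasis ℂ V).starProjection_eq_sum_rankOne, Finset.sum_mul]
  refine Submodule.sum_mem _ fun i _ => Submodule.subset_span 
    ⟨_, _, InnerProductSpace.rankOne_comp _ _ T⟩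

/-- A compact operator on a Hilbert space is a norm limit of operators of finite rank. -/
theorem compactOps_subset_closure_span :
    (compactOps H : Set (H →L[ℂ] H)) ⊆ closure (Submodule.span ℂ
      {t | ∃ f g : H, t = InnerProductSpace.rankOne ℂ g f} : Set (H →L[ℂ] H)) := by
  intro T hT
  have hT : IsCompactOperator T := hT
  have h1 : TotallyBounded (T '' Metric.closedBall 0 1) :=
    ((isCompactOperator_iff_isCompact_closure_image_closedBall
      T.toLinearMap one_pos).1 hT).totallyBounded.subset subset_closure
  refine Metric.mem_closure_iff.2 fun ε hε => ?_
  obtain ⟨t, htf, ht⟩ := Metric.totallyBounded_iff.1 h1 (ε / 2) (by positivity)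
  -- Projecting onto the span of a finite net moves each point of the image of the ball at most as
  -- far as its nearest net point. The radius `ε / 2` restores strictness, as the operator norm
  -- estimate gives only `≤`.
  let V := Submodule.span ℂ t
  have : FiniteDimensional ℂ V := FiniteDimensional.span_of_finite ℂ htf
  refine ⟨V.starProjection * T, starProjection_mul_mem_span V T, ?_⟩
  rw [dist_eq_norm]
  refine lt_of_le_of_lt (ContinuousLinearMap.opNorm_le_of_unit_norm (C := ε / 2) (by positivity)
    fun x hx => ?_) (by linarith)
  obtain ⟨y, hy, hxy⟩ := Set.mem_iUnion₂.1
    (ht ⟨x, mem_closedBall_zero_iff.2 hx.le, rfl⟩)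
  rw [Metric.mem_ball, dist_eq_norm] at hxy
  refine le_trans ?_ hxy.le
  rw [sub_apply, mul_apply_eq_comp, Submodule.starProjection_minimal]
  exact ciInf_le ⟨0, by rintro _ ⟨_, rfl⟩; exact norm_nonneg _⟩
    (⟨y, Submodule.subset_span hy⟩ : V)

theorem rankOne_mem_compactOps (f g : H) :
    InnerProductSpace.rankOne ℂ g f ∈ compactOps H := by
  change IsCompactOperator (InnerProductSpace.rankOne ℂ g f)
  rw [InnerProductSpace.rankOne_def']
  have h : IsCompactOperator (ContinuousLinearMap.toSpanSingleton ℂ g) :=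
    isCompactOperator_of_locallyCompactSpace_rng _
  exact h.comp_clm (innerSL ℂ f)

variable {S : NonUnitalStarSubalgebra ℂ (K →L[ℂ] K)} (hS : ∀ s, s ∈ S ↔ ∃ a : A, ρ (.op a) = s)

theorem HilbertTensor.induction {A H : Type*} [CStarAlgebra A] [PartialOrder A] [StarOrderedRing A]
    [NormedAddCommGroup H] [InnerProductSpace ℂ H] {p : HilbertTensor A H → Prop}
    (x : HilbertTensor A H) (hc : IsClosed {x | p x}) (zero : p 0)
    (tmul : ∀ a f, p (tmul a f)) (add : ∀ x y, p x → p y → p (x + y)) : p x := by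
  refine UniformSpace.Completion.induction_on (α := PreTensor A H) x hc fun a => ?_
  refine TensorProduct.induction_on (motive := fun a => p (UniformSpace.Completion.coe'
    (α := PreTensor A H) a)) a ?_ tmul fun s t hs ht => ?_
  · exact (congrArg p (UniformSpace.Completion.coe_zero (α := PreTensor A H))).mpr zero
  · exact (congrArg p (UniformSpace.Completion.coe_add (α := PreTensor A H) s t)).mpr
      (add _ _ hs ht)

/-- As `π` is sesquilinear and jointly continuous, and elementary tensors are total in the module,
one argument at a time can be reduced to elementary tensors. -/
theorem compacts_subset_of_tmul {A H : Type*} [CStarAlgebra A] [PartialOrder A]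
    [StarOrderedRing A] [NormedAddCommGroup H] [InnerProductSpace ℂ H]
    {q : Submodule ℂ (Adjointable A (HilbertTensor A H))}
    (hq : IsClosed (q : Set (Adjointable A (HilbertTensor A H))))
    (h : ∀ (a b : A) (f g : H), rankOne A (tmul a f) (tmul b g) ∈ q)
    {T : Adjointable A (HilbertTensor A H)} (hT : T ∈ compacts A (HilbertTensor A H)) : T ∈ q := by
  have h1 : ∀ (x : HilbertTensor A H) (b : A) (g : H), rankOne A x (tmul b g) ∈ q := by
    intro x b g
    induction x using HilbertTensor.induction with
    | hc => exact hq.preimage (continuous_rankOne.comp (continuous_id.prodMk continuous_const))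
    | zero =>
      rw [← rankOneSL_apply, map_zero, zero_apply]
      exact zero_mem _
    | add x x' h h' =>
      rw [rankOne_add_left]
      exact add_mem h h'
    | tmul a f => exact h a b f g
  have h2 : ∀ x y : HilbertTensor A H, rankOne A x y ∈ q := by
    intro x y
    induction y using HilbertTensor.induction with
    | hc => exact hq.preimage (continuous_rankOne.comp (continuous_const.prodMk continuous_id))
    | zero =>
      rw [← rankOneSL_apply, map_zero]
      exact zero_mem _
    | add y y' h h' =>
      rw [rankOne_add_right]
      exact add_mem h h'
    | tmul b g => exact h1 x b g
  refine closure_minimal (Submodule.span_le.2 ?_) hq hT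
  rintro _ ⟨x, y, rfl⟩
  exact h2 x y

include hS in
theorem amplifyHom_mem {T : Adjointable A (HilbertTensor A H)}
    (hT : T ∈ compacts A (HilbertTensor A H)) :
    amplifyHom hρ hv T ∈ spatialTensor S (compactOps H) := by
  let p := spatialTensor S (compactOps H)
  have hp : IsClosed (p : Set (HilbertProd K H →L[ℂ] HilbertProd K H)) :=
    NonUnitalStarSubalgebra.isClosed_topologicalClosure _
  let q : Submodule ℂ (Adjointable A (HilbertTensor A H)) :=
    { carrier := {T | amplifyHom hρ hv T ∈ p}
      add_mem' := fun {T T'} h h' => by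
        change amplifyHom hρ hv (T + T') ∈ p
        rw [map_add]
        exact add_mem h h'
      zero_mem' := by
        change amplifyHom hρ hv 0 ∈ p
        rw [map_zero]
        exact zero_mem p
      smul_mem' := fun z T h => by
        change amplifyHom hρ hv (z • T) ∈ p
        rw [map_smul]
        exact SMulMemClass.smul_mem z h }
  refine compacts_subset_of_tmul (q := q)
    (hp.preimage (isometry_amplifyHom (H := H) hρ hv).continuous) (fun a b f g => ?_) hT
  change amplifyHom hρ hv _ ∈ p
  rw [amplifyHom_rankOne]
  exact NonUnitalStarSubalgebra.le_topologicalClosure _ (NonUnitalStarAlgebra.subset_adjoin ℂ _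
    ⟨_, (hS _).2 ⟨_, rfl⟩, _, rankOne_mem_compactOps f g, rfl⟩)

-- The image of the compacts is a closed star subalgebra, so only the generators `s ⊗ t` matter, and
-- by continuity in `t` only those with `t` of rank one.
include hS in
theorem exists_amplifyHom_eq {x : HilbertProd K H →L[ℂ] HilbertProd K H}
    (hx : x ∈ spatialTensor S (compactOps H)) :
    ∃ T ∈ compacts A (HilbertTensor A H), amplifyHom hρ hv T = x := by
  let p : NonUnitalStarSubalgebra ℂ (HilbertProd K H →L[ℂ] HilbertProd K H) :=
    (compacts A (HilbertTensor A H)).map (amplifyHom hρ hv)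
  have hc : IsClosed (p : Set (HilbertProd K H →L[ℂ] HilbertProd K H)) :=
    isClosed_image_compacts (H := H) hρ hv
  refine NonUnitalStarSubalgebra.topologicalClosure_minimal (t := p) _
    (NonUnitalStarAlgebra.adjoin_le ?_) hc hx
  rintro _ ⟨s, hs, t, ht, rfl⟩
  obtain ⟨a, rfl⟩ := (hS s).1 hs
  refine closure_minimal (fun t ht => ?_) (hc.preimage (continuous_opTensor_right (ρ (.op a))))
    (compactOps_subset_closure_span ht)
  change opTensor _ t ∈ p
  induction ht using Submodule.span_induction with
  | mem t h =>
    obtain ⟨f, g, rfl⟩ := h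
    -- The unit of `A` in the first slot makes the algebra factor `star 1 * a = a`.
    refine ⟨rankOne A (tmul 1 f) (tmul a g), rankOne_mem A _ _, ?_⟩
    refine (amplifyHom_rankOne hρ hv 1 a f g).trans ?_
    rw [star_one, one_mul]
  | zero =>
    have h : opTensor (ρ (.op a)) (0 : H →L[ℂ] H) = 0 := by
      rw [← zero_smul ℂ (0 : H →L[ℂ] H), opTensor_smul_right, zero_smul]
    rw [h]
    exact zero_mem p
  | add t t' _ _ h h' => rw [opTensor_add_right]; exact add_mem h h'
  | smul z t _ h => rw [opTensor_smul_right]; exact SMulMemClass.smul_mem z h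

/-- The C⋆-algebra of `A`-compact operators on `A ⊗ H` is the spatial tensor product of the
opposite algebra with the compact operators on `H`. -/
def compactEquiv : CompactAlgebra A (HilbertTensor A H) ≃⋆ₐ[ℂ] spatialTensor S (compactOps H) :=
  StarAlgEquiv.ofBijective (A := compacts A (HilbertTensor A H))
    (NonUnitalStarAlgHom.codRestrict ((amplifyHom hρ hv).comp
      (NonUnitalStarSubalgebraClass.subtype (compacts A (HilbertTensor A H))))
      (spatialTensor S (compactOps H)) fun T => amplifyHom_mem hρ hv hS T.2) (by
    constructor
    · intro T T' h
      exact Subtype.ext ((isometry_amplifyHom hρ hv).injective (congrArg Subtype.val h))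
    · rintro ⟨x, hx⟩
      obtain ⟨T, hT, rfl⟩ := exists_amplifyHom_eq hρ hv hS hx
      exact ⟨⟨T, hT⟩, rfl⟩)

theorem coe_compactEquiv_rankOne (a b : A) (f g : H) :
    (compactEquiv hρ hv hS (CompactAlgebra.rankOne A (tmul a f) (tmul b g)) :
      HilbertProd K H →L[ℂ] HilbertProd K H)
      = opTensor (ρ (.op (star a * b))) (InnerProductSpace.rankOne ℂ g f) :=
  amplifyHom_rankOne hρ hv a b f g

end Range

end

end GaugePeriodic

theorem mainTheorem10 {Γ H : Type*} [Group Γ] (Θ : GaugePeriodic.Cocycle Γ)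
    [NormedAddCommGroup H] [InnerProductSpace ℂ H] [CompleteSpace H] :
    ∃ φ : (GaugePeriodic.TwistedAlgebra Θ)ᵐᵒᵖ ≃⋆ₐ[ℂ] GaugePeriodic.leftAlgebra Θ,
      (∀ γ : Γ, (φ (MulOpposite.op (star (GaugePeriodic.TwistedAlgebra.R Θ γ))) :
          GaugePeriodic.L2 Γ →L[ℂ] GaugePeriodic.L2 Γ) = GaugePeriodic.leftTranslation Θ γ) ∧
      ∃ Ψ : GaugePeriodic.CompactAlgebra (GaugePeriodic.TwistedAlgebra Θ)
            (GaugePeriodic.HilbertTensor (GaugePeriodic.TwistedAlgebra Θ) H) ≃⋆ₐ[ℂ]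
          GaugePeriodic.spatialTensor (GaugePeriodic.leftAlgebra Θ).toNonUnitalStarSubalgebra
            (GaugePeriodic.compactOps H),
        ∀ (a b : GaugePeriodic.TwistedAlgebra Θ) (f g : H),
          (Ψ (GaugePeriodic.CompactAlgebra.rankOne (GaugePeriodic.TwistedAlgebra Θ)
              (GaugePeriodic.tmul a f) (GaugePeriodic.tmul b g)) :
            GaugePeriodic.HilbertProd (GaugePeriodic.L2 Γ) H →L[ℂ]
              GaugePeriodic.HilbertProd (GaugePeriodic.L2 Γ) H)
          = GaugePeriodic.opTensor
              (φ (MulOpposite.op (star a * b)) : GaugePeriodic.L2 Γ →L[ℂ] GaugePeriodic.L2 Γ)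
              (InnerProductSpace.rankOne ℂ g f) := by
  classical
  refine ⟨GaugePeriodic.opEquiv Θ, GaugePeriodic.opRep_star_R Θ,
    GaugePeriodic.compactEquiv (GaugePeriodic.norm_opRep_op Θ) (GaugePeriodic.denseRange_opRep Θ)
      (S := (GaugePeriodic.leftAlgebra Θ).toNonUnitalStarSubalgebra) fun T => ?_,
    fun a b f g => GaugePeriodic.coe_compactEquiv_rankOne _ _ _ a b f g⟩
  constructor
  · exact fun hT => GaugePeriodic.exists_opRep_eq Θ hT
  · rintro ⟨a, rfl⟩
    exact GaugePeriodic.opRep_mem Θ _
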